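/- Let $b\in\mathbb R$ and let $\mu$ be a Borel measure on $(0,\infty)$ whose tail $\bar\mu(x):=\mu([x,\infty))$ is finite for every $x>0$. Let $\mathcal N$ be a Poisson point process on $[0,\infty)\times(0,\infty)$ with intensity $\lambda\otimes\mu$, where $\lambda$ is the Lebesgue measure. For $x\ge 0$ let $\mathcal N^x:=\delta_{(0,x)}+\mathcal N$ and let $$M^x(t):=\sup\big\{(\xi-b(t-s))_+ : (s,\xi)\text{ is an atom of }\mathcal N^x,\ 0\le s\le t\big\},\qquad t\ge 0,$$ be the extremal shot noise process $\mathrm{ESN}(b,\mu)$ started from $x$. Let $P_tf(x):=\mathbb E[f(M^x(t))]$ for $f$ in the space $C_0([0,\infty))$ of real continuous functions on $[0,\infty)$ vanishing at $\infty$, equipped with the supremum norm, and let $(\mathcal A,\mathcal D(\mathcal A))$ be its generator: $f\in\mathcal D(\mathcal A)$ and $\mathcal Af=g$ mean that $f,g\in C_0([0,\infty))$ and $(P_tf-f)/t\to g$ uniformly on $[0,\infty)$ as $t\to0+$. A set $D\subset\mathcal D(\mathcal A)$ is a core for $\mathcal A$ if $\mathcal A$ is the closure of its restriction to $D$. Let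 $C^{1,0}([0,\infty))$ be the set of continuously differentiable functions on $[0,\infty)$ (with one-sided derivative at $0$) that vanish at $\infty$ and whose derivative vanishes at $\infty$, and set $$\mathcal D_0:=\{f\in C^{1,0}([0,\infty)): \exists\,\epsilon>0 \text{ such that } f_{|[0,\epsilon]}\text{ is constant}\},$$ $$\mathcal D_1:=\Big\{f\in C^{1,0}([0,\infty)): f'(0)=0\text{ and }\int_0^1|f'(v)|\,\bar\mu(v)\,\mathrm dv<\infty\Big\}.$$ Then: 1. $\mathcal D_0\subset\mathcal D_1\subset\mathcal D(\mathcal A)$. 2. For every $f\in\mathcal D_1$ and every $x\ge0$, the function $y\mapsto f(y)-f(x)$ is $\mu$-integrable on $(x,\infty)$ and $$\mathcal Af(x)=\int_{(x,\infty)}\big(f(y)-f(x)\big)\,\mu(\mathrm dy)-b f'(x).$$ 3. If $b>0$, then $\mathcal D_0$ and $\mathcal D_1$ are both cores for $\mathcal A$. 4. If $b\le0$ and $\int_0^1\bar\mu(v)\,\mathrm dv=\infty$, then $\mathcal D_1$ is a core for $\mathcal A$. -/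

import Mathlib

open MeasureTheory ProbabilityTheory Set Filter Topology
open scoped ENNReal NNReal ZeroAtInfty

noncomputable section

namespace ESN

/-- The Poisson law with parameter `r ∈ [0, ∞]`, as a measure on `{0, 1, …, ∞}`; the law with
parameter `∞` is the unit mass at `∞`. -/
def poissonLaw (r : ℝ≥0∞) : Measure ℕ∞ :=
  if r = ∞ then Measure.dirac ⊤ else (poissonMeasure r.toNNReal).map (fun n : ℕ => (n : ℕ∞))

/-- Poisson point process with intensity `ν`, given by its random countable set of atoms `S`:
the number of atoms in a measurable set `A` is Poisson with parameter `ν A`, and the numbers of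
atoms in disjoint measurable sets are independent. (The intensities used below have no atoms,
so that the point process is almost surely simple and is determined by its set of atoms.) -/
structure IsPoissonPointProcess {Ω E : Type*} [MeasurableSpace Ω] [MeasurableSpace E]
    (P : Measure Ω) (S : Ω → Set E) (ν : Measure E) : Prop where
  countable : ∀ᵐ ω ∂P, (S ω).Countable
  hasLaw : ∀ A : Set E, MeasurableSet A →
    HasLaw (fun ω => (S ω ∩ A).encard) (poissonLaw (ν A)) P
  indep : ∀ (n : ℕ) (A : Fin n → Set E), (∀ i, MeasurableSet (A i)) →
    Pairwise (fun i j => Disjoint (A i) (A j)) →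
    iIndepFun (fun i ω => (S ω ∩ A i).encard) P

/-- The measure `λ ⊗ μ` on `[0, ∞) × (0, ∞)`, `λ` the Lebesgue measure (`μ` is a measure carried
by `(0, ∞)`). -/
def intensity (μ : Measure ℝ) : Measure (ℝ × ℝ) :=
  (volume.restrict (Ici (0 : ℝ))).prod μ

/-- The value at time `t` of the extremal shot noise process with slope `b` started from `x` and
driven by the atoms `(s, ξ) ∈ A`: the supremum of `(ξ - b (t - s))₊` over all the atoms
`(s, ξ)` of `A ∪ {(0, x)}` with `0 ≤ s ≤ t`. The supremum is taken in `[0, ∞]`. -/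
def process (b : ℝ) (A : Set (ℝ × ℝ)) (x t : ℝ≥0) : ℝ≥0∞ :=
  ⨆ p ∈ {p : ℝ × ℝ | p ∈ insert ((0 : ℝ), (x : ℝ)) A ∧ 0 ≤ p.1 ∧ p.1 ≤ t},
    ENNReal.ofReal (p.2 - b * (t - p.1))

/-- `P_t f (x) = 𝔼[f(M^x(t))]`, the semigroup of the extremal shot noise process. (`M^x(t)` is
almost surely finite when the atoms are those of a Poisson point process with intensity
`λ ⊗ μ`, `μ [y, ∞) < ∞` for `y > 0`.) -/
def semigroup {Ω : Type*} [MeasurableSpace Ω] (P : Measure Ω) (b : ℝ)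
    (S : Ω → Set (ℝ × ℝ)) (t : ℝ≥0) (f : C₀(ℝ≥0, ℝ)) (x : ℝ≥0) : ℝ :=
  ∫ ω, f (process b (S ω) x t).toNNReal ∂P

/-- The graph of the infinitesimal generator of a family of operators `T t`, `t ≥ 0`, on
`C₀([0, ∞))`: the pairs `(f, g)` with `(T t f - f) / t → g` uniformly as `t → 0+`. -/
def generatorGraph (T : ℝ≥0 → C₀(ℝ≥0, ℝ) → ℝ≥0 → ℝ) : Set (C₀(ℝ≥0, ℝ) × C₀(ℝ≥0, ℝ)) :=
  {q | TendstoUniformly (fun (t : ℝ≥0) (x : ℝ≥0) => (T t q.1 x - q.1 x) / (t : ℝ))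
    (fun x => q.2 x) (𝓝[>] 0)}

/-- The domain of an operator given by its graph. -/
def domain (G : Set (C₀(ℝ≥0, ℝ) × C₀(ℝ≥0, ℝ))) : Set C₀(ℝ≥0, ℝ) :=
  {f | ∃ g, (f, g) ∈ G}

/-- `D` is a core of the operator with graph `G`: it is contained in the domain, and the operator
is the closure of its restriction to `D`. -/
def IsCore (G : Set (C₀(ℝ≥0, ℝ) × C₀(ℝ≥0, ℝ))) (D : Set C₀(ℝ≥0, ℝ)) : Prop :=
  D ⊆ domain G ∧ closure {q | q ∈ G ∧ q.1 ∈ D} = G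

/-- A function on `[0, ∞)` seen as a function on `ℝ`; only its values on `[0, ∞)` are used. -/
def toRealFun (f : C₀(ℝ≥0, ℝ)) (x : ℝ) : ℝ := f x.toNNReal

/-- The derivative on `[0, ∞)`, one-sided at `0`. -/
def deriv₀ (f : C₀(ℝ≥0, ℝ)) (x : ℝ) : ℝ := derivWithin (toRealFun f) (Ici 0) x

/-- The continuously differentiable functions on `[0, ∞)` vanishing at infinity, with a
derivative vanishing at infinity. -/
def C10 : Set C₀(ℝ≥0, ℝ) :=
  {f | ContDiffOn ℝ 1 (toRealFun f) (Ici 0) ∧ Tendsto (deriv₀ f) atTop (𝓝 0)}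

/-- The functions of `C10` that are constant near `0`. -/
def D0 : Set C₀(ℝ≥0, ℝ) :=
  {f | f ∈ C10 ∧ ∃ ε : ℝ≥0, 0 < ε ∧ ∀ x ≤ ε, f x = f 0}

/-- The functions `f` of `C10` with `f'(0) = 0` and `∫_0^1 |f'(v)| μ[v, ∞) dv < ∞`. -/
def D1 (μ : Measure ℝ) : Set C₀(ℝ≥0, ℝ) :=
  {f | f ∈ C10 ∧ deriv₀ f 0 = 0 ∧ ∫⁻ v in Ioc (0 : ℝ) 1, ‖deriv₀ f v‖ₑ * μ (Ici v) < ∞}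

end ESN

end

/-! ### Contraction semigroups on normed spaces and their generators -/

section Semigroup

variable {X : Type*} [NormedAddCommGroup X] [NormedSpace ℝ X]

/-- A strongly continuous semigroup of linear contractions. -/
structure IsContractionSemigroup (T : ℝ≥0 → X →ₗ[ℝ] X) : Prop where
  norm_le : ∀ t x, ‖T t x‖ ≤ ‖x‖
  add_apply : ∀ s t x, T (s + t) x = T s (T t x)
  tendsto_zero : ∀ x, Tendsto (fun t => T t x) (𝓝[>] 0) (𝓝 x)

/-- The graph of the infinitesimal generator of a family of linear operators. -/
def infinitesimalGraph (T : ℝ≥0 → X →ₗ[ℝ] X) : Set (X × X) :=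
  {q | Tendsto (fun t : ℝ≥0 => (t : ℝ)⁻¹ • (T t q.1 - q.1)) (𝓝[>] 0) (𝓝 q.2)}

namespace IsContractionSemigroup

variable {T : ℝ≥0 → X →ₗ[ℝ] X}

theorem zero_apply (hT : IsContractionSemigroup T) (x : X) : T 0 x = x := by
  have h1 : Tendsto (fun t => T t x) (𝓝[>] 0) (𝓝 (T 0 x)) := by
    have h : Tendsto (fun t => T 0 (T t x)) (𝓝[>] 0) (𝓝 (T 0 x)) := by
      rw [tendsto_iff_norm_sub_tendsto_zero]
      refine squeeze_zero (fun _ => norm_nonneg _) (fun t => ?_)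
        (tendsto_iff_norm_sub_tendsto_zero.1 (hT.tendsto_zero x))
      rw [← map_sub]
      exact hT.norm_le _ _
    refine h.congr fun t => ?_
    rw [← hT.add_apply, zero_add]
  exact tendsto_nhds_unique h1 (hT.tendsto_zero x)

theorem exists_forall_le_norm_sub_le (hT : IsContractionSemigroup T) (x : X) {ε : ℝ} (hε : 0 < ε) :
    ∃ t₀ : ℝ≥0, 0 < t₀ ∧ ∀ t ≤ t₀, ‖T t x - x‖ ≤ ε := by
  have h := (hT.tendsto_zero x).eventually (Metric.ball_mem_nhds x hε)
  obtain ⟨t₀, ht₀, h⟩ := mem_nhdsGT_iff_exists_Ioc_subset.1 h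
  refine ⟨t₀, ht₀, fun t ht => ?_⟩
  rcases eq_or_ne t 0 with rfl | h0
  · simpa [hT.zero_apply] using hε.le
  · have : dist (T t x) x < ε := h ⟨pos_iff_ne_zero.2 h0, ht⟩
    rw [dist_eq_norm] at this
    exact this.le

theorem norm_iterate_sub_le (hT : IsContractionSemigroup T) {f g : X} {h : ℝ≥0} {M : ℝ} (n : ℕ)
    (hM : ∀ s ≤ n * h, ‖T s g - g‖ ≤ M) :
    ‖T (n * h) f - f - ((n * h : ℝ≥0) : ℝ) • g‖ ≤
      n * (‖T h f - f - (h : ℝ) • g‖ + h * M) := by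
  induction n with
  | zero => simp [hT.zero_apply]
  | succ n ih =>
    have hle : (n : ℝ≥0) * h ≤ ((n + 1 : ℕ) : ℝ≥0) * h := by
      gcongr
      exact Nat.le_succ n
    have ih' := ih fun s hs => hM s (hs.trans hle)
    have key : T ((n + 1 : ℕ) * h) f - f - (((n + 1 : ℕ) * h : ℝ≥0) : ℝ) • g =
        T (n * h) (T h f - f - (h : ℝ) • g) + (h : ℝ) • (T (n * h) g - g) +
          (T (n * h) f - f - ((n * h : ℝ≥0) : ℝ) • g) := by
      have : ((n + 1 : ℕ) : ℝ≥0) * h = n * h + h := by push_cast; ring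
      rw [this, hT.add_apply]
      simp only [map_sub, map_smul, NNReal.coe_add, add_smul, smul_sub]
      abel
    rw [key]
    refine (norm_add_le _ _).trans ?_
    have h1 := norm_add_le (T (n * h) (T h f - f - (h : ℝ) • g)) ((h : ℝ) • (T (n * h) g - g))
    have h2 := hT.norm_le (n * h) (T h f - f - (h : ℝ) • g)
    have h3 : ‖(h : ℝ) • (T (n * h) g - g)‖ ≤ h * M := by
      rw [norm_smul, Real.norm_of_nonneg h.coe_nonneg]
      exact mul_le_mul_of_nonneg_left (hM _ hle) h.coe_nonneg
    push_cast at ih' ⊢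
    linarith

theorem norm_sub_sub_smul_le (hT : IsContractionSemigroup T) {f g : X}
    (hfg : (f, g) ∈ infinitesimalGraph T) {t : ℝ≥0} {M : ℝ} (hM : ∀ s ≤ t, ‖T s g - g‖ ≤ M) :
    ‖T t f - f - (t : ℝ) • g‖ ≤ t * M := by
  rcases eq_or_ne t 0 with rfl | ht
  · simp [hT.zero_apply]
  have ht' : (0 : ℝ) < t := by positivity
  have hseq : Tendsto (fun n : ℕ => t / ((n : ℝ≥0) + 1)) atTop (𝓝[>] 0) := by
    refine tendsto_nhdsWithin_iff.2 ⟨?_, Eventually.of_forall fun n => by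
      simp only [mem_Ioi]; positivity⟩
    rw [← NNReal.tendsto_coe]
    push_cast
    have := (tendsto_one_div_add_atTop_nhds_zero_nat (𝕜 := ℝ)).const_mul (t : ℝ)
    simpa [div_eq_mul_inv] using this
  have hlim := (tendsto_iff_norm_sub_tendsto_zero.1 (hfg.comp hseq)).const_mul (t : ℝ)
  have hlim' := hlim.add_const (t * M)
  rw [mul_zero, zero_add] at hlim'
  refine ge_of_tendsto' hlim' fun n => ?_
  set h : ℝ≥0 := t / ((n : ℝ≥0) + 1) with hh
  have hn : (((n + 1 : ℕ) : ℝ≥0)) * h = t := by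
    rw [hh]; push_cast; field_simp
  have hpos : (0 : ℝ) < h := by
    have : 0 < h := by rw [hh]; positivity
    exact_mod_cast this
  have hn' : ((n + 1 : ℕ) : ℝ) * (h : ℝ) = t := by
    have := congrArg (fun z : ℝ≥0 => (z : ℝ)) hn
    simpa using this
  have := hT.norm_iterate_sub_le (f := f) (g := g) (h := h) (M := M) (n + 1) (by rwa [hn])
  rw [hn, mul_add, ← mul_assoc, hn'] at this
  refine this.trans_eq ?_
  congr 1
  have : T h f - f - (h : ℝ) • g = (h : ℝ) • ((h : ℝ)⁻¹ • (T h f - f) - g) := by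
    rw [smul_sub, smul_smul, mul_inv_cancel₀ hpos.ne', one_smul]
  rw [this, norm_smul, Real.norm_of_nonneg hpos.le, ← mul_assoc, hn']
  rfl

theorem isClosed_infinitesimalGraph (hT : IsContractionSemigroup T) :
    IsClosed (infinitesimalGraph T) := by
  refine isClosed_of_closure_subset ?_
  rintro ⟨f, g⟩ hfg
  obtain ⟨u, hu, hlim⟩ := mem_closure_iff_seq_limit.1 hfg
  have hlim1 : Tendsto (fun n => (u n).1) atTop (𝓝 f) := (continuous_fst.tendsto _).comp hlim
  have hlim2 : Tendsto (fun n => (u n).2) atTop (𝓝 g) := (continuous_snd.tendsto _).comp hlim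
  have hbound : ∀ (t : ℝ≥0) (M : ℝ), (∀ s ≤ t, ‖T s g - g‖ ≤ M) →
      ‖T t f - f - (t : ℝ) • g‖ ≤ t * M := by
    intro t M hM
    have hTl : Tendsto (fun n => T t (u n).1) atTop (𝓝 (T t f)) := by
      rw [tendsto_iff_norm_sub_tendsto_zero] at hlim1 ⊢
      refine squeeze_zero (fun _ => norm_nonneg _) (fun n => ?_) hlim1
      rw [← map_sub]
      exact hT.norm_le _ _
    have hl : Tendsto (fun n => ‖T t (u n).1 - (u n).1 - (t : ℝ) • (u n).2‖) atTop
        (𝓝 ‖T t f - f - (t : ℝ) • g‖) := ((hTl.sub hlim1).sub (hlim2.const_smul _)).norm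
    have hr : Tendsto (fun n => (t : ℝ) * (M + 2 * ‖(u n).2 - g‖)) atTop (𝓝 (t * M)) := by
      have := (((tendsto_iff_norm_sub_tendsto_zero.1 hlim2).const_mul 2).const_add M).const_mul
        (t : ℝ)
      simpa using this
    refine le_of_tendsto_of_tendsto' hl hr fun n => ?_
    refine hT.norm_sub_sub_smul_le (hu n) fun s hs => ?_
    have : T s (u n).2 - (u n).2 = T s ((u n).2 - g) + (T s g - g) - ((u n).2 - g) := by
      rw [map_sub]; abel
    rw [this]
    have h1 := norm_sub_le (T s ((u n).2 - g) + (T s g - g)) ((u n).2 - g)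
    have h2 := norm_add_le (T s ((u n).2 - g)) (T s g - g)
    have h3 := hT.norm_le s ((u n).2 - g)
    have h4 := hM s hs
    linarith
  change Tendsto _ _ _
  rw [Metric.tendsto_nhds]
  intro ε hε
  obtain ⟨t₀, ht₀, hM⟩ := hT.exists_forall_le_norm_sub_le g (half_pos hε)
  filter_upwards [Ioc_mem_nhdsGT ht₀] with t ht
  have htpos : (0 : ℝ) < t := ht.1
  have := hbound t (ε / 2) fun s hs => hM s (hs.trans ht.2)
  rw [dist_eq_norm]
  have heq : (t : ℝ)⁻¹ • (T t f - f) - g = (t : ℝ)⁻¹ • (T t f - f - (t : ℝ) • g) := by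
    rw [smul_sub _ _ ((t : ℝ) • g), smul_smul, inv_mul_cancel₀ htpos.ne', one_smul]
  change ‖(t : ℝ)⁻¹ • (T t f - f) - g‖ < ε
  rw [heq, norm_smul, Real.norm_of_nonneg (by positivity)]
  calc (t : ℝ)⁻¹ * ‖T t f - f - (t : ℝ) • g‖ ≤ (t : ℝ)⁻¹ * (t * (ε / 2)) := by gcongr
    _ = ε / 2 := by field_simp
    _ < ε := half_lt_self hε

theorem norm_le_norm_sub (hT : IsContractionSemigroup T) {f g : X}
    (hfg : (f, g) ∈ infinitesimalGraph T) : ‖f‖ ≤ ‖f - g‖ := by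
  have hlim : Tendsto (fun t : ℝ≥0 => ‖f - (t : ℝ)⁻¹ • (T t f - f)‖) (𝓝[>] 0) (𝓝 ‖f - g‖) :=
    (tendsto_const_nhds.sub hfg).norm
  refine ge_of_tendsto hlim ?_
  filter_upwards [self_mem_nhdsWithin] with t ht
  have htpos : (0 : ℝ) < t := ht
  have heq : f - (t : ℝ)⁻¹ • (T t f - f) = (1 + (t : ℝ)⁻¹) • f - (t : ℝ)⁻¹ • T t f := by
    rw [smul_sub, add_smul, one_smul]; abel
  have h1 := norm_sub_norm_le ((1 + (t : ℝ)⁻¹) • f) ((t : ℝ)⁻¹ • T t f)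
  rw [← heq, norm_smul, norm_smul, Real.norm_of_nonneg (by positivity),
    Real.norm_of_nonneg (by positivity)] at h1
  have h2 : (t : ℝ)⁻¹ * ‖T t f‖ ≤ (t : ℝ)⁻¹ * ‖f‖ := by
    gcongr
    exact hT.norm_le t f
  linarith

theorem infinitesimalGraph_sub {p q : X × X} (hp : p ∈ infinitesimalGraph T)
    (hq : q ∈ infinitesimalGraph T) : p - q ∈ infinitesimalGraph T := by
  have := Tendsto.sub hp hq
  refine this.congr fun t => ?_
  rw [Prod.fst_sub, map_sub, ← smul_sub]
  congr 1
  abel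

/-- If `1 - A` has dense range on `D`, then `A` is the closure of its restriction to `D`. -/
theorem closure_restrict_eq (hT : IsContractionSemigroup T) (D : Set X)
    (hD : ∀ k : X, ∀ ε > 0, ∃ q ∈ infinitesimalGraph T, q.1 ∈ D ∧ ‖q.1 - q.2 - k‖ < ε) :
    closure {q | q ∈ infinitesimalGraph T ∧ q.1 ∈ D} = infinitesimalGraph T := by
  refine Subset.antisymm (closure_minimal (fun q hq => hq.1) hT.isClosed_infinitesimalGraph) ?_
  rintro ⟨f, g⟩ hfg
  rw [Metric.mem_closure_iff]
  intro ε hε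
  obtain ⟨⟨f', g'⟩, hq, hqD, hq'⟩ := hD (f - g) (ε / 2) (half_pos hε)
  refine ⟨(f', g'), ⟨hq, hqD⟩, ?_⟩
  have h1 := hT.norm_le_norm_sub (infinitesimalGraph_sub hfg hq)
  dsimp only at h1 hq'
  have h2 : f - f' - (g - g') = -(f' - g' - (f - g)) := by abel
  rw [h2, norm_neg] at h1
  have h3 : g - g' = (f - f') + (f' - g' - (f - g)) := by abel
  have h4 : ‖g - g'‖ ≤ ‖f - f'‖ + ‖f' - g' - (f - g)‖ := by
    rw [h3]; exact norm_add_le _ _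
  rw [Prod.dist_eq, max_lt_iff, dist_eq_norm, dist_eq_norm]
  constructor <;> dsimp only <;> linarith

end IsContractionSemigroup

end Semigroup

namespace ESN

/-! ### The law of the noise -/

theorem poissonLaw_singleton_zero (r : ℝ≥0∞) :
    poissonLaw r {0} = if r = ∞ then 0 else ENNReal.ofReal (Real.exp (-r.toReal)) := by
  unfold poissonLaw
  split_ifs with h
  · simp
  · rw [Measure.map_apply (measurable_of_countable _) (measurableSet_singleton _)]
    have : (fun n : ℕ => (n : ℕ∞)) ⁻¹' {0} = {0} := by ext; simp
    rw [this, poissonMeasure_singleton]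
    simp [ENNReal.coe_toNNReal_eq_toReal]

theorem poissonLaw_add_singleton_zero (r s : ℝ≥0∞) :
    poissonLaw (r + s) {0} = poissonLaw r {0} * poissonLaw s {0} := by
  simp only [poissonLaw_singleton_zero, ENNReal.add_eq_top]
  by_cases hr : r = ∞
  · simp [hr]
  by_cases hs : s = ∞
  · simp [hs]
  simp only [hr, hs, or_self, if_false]
  rw [← ENNReal.ofReal_mul (Real.exp_nonneg _), ← Real.exp_add, ENNReal.toReal_add hr hs]
  congr 2
  ring

theorem one_sub_poissonLaw_le (r : ℝ≥0∞) : 1 - poissonLaw r {0} ≤ r := by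
  rw [poissonLaw_singleton_zero]
  split_ifs with h
  · simp [h]
  · rw [tsub_le_iff_right, ← ENNReal.ofReal_toReal h, ENNReal.toReal_ofReal ENNReal.toReal_nonneg,
      ← ENNReal.ofReal_add ENNReal.toReal_nonneg (Real.exp_nonneg _), ENNReal.one_le_ofReal]
    have := Real.add_one_le_exp (-r.toReal)
    linarith

/-- The mean number of atoms whose contribution at time `t` exceeds `y`. -/
noncomputable def meanExceed (μ : Measure ℝ) (b : ℝ) (t : ℝ≥0) (y : ℝ) : ℝ≥0∞ :=
  ∫⁻ r in Icc (0 : ℝ) t, μ (Ioi (y + b * (t - r)))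

/-- The contribution of the atoms in `A` to the process at time `t`. -/
noncomputable def noise (b : ℝ) (A : Set (ℝ × ℝ)) (t : ℝ≥0) : ℝ≥0∞ :=
  ⨆ p ∈ {p : ℝ × ℝ | p ∈ A ∧ 0 ≤ p.1 ∧ p.1 ≤ t}, ENNReal.ofReal (p.2 - b * (t - p.1))

theorem process_eq_max (b : ℝ) (A : Set (ℝ × ℝ)) (x t : ℝ≥0) :
    process b A x t = max (ENNReal.ofReal (x - b * t)) (noise b A t) := by
  apply le_antisymm
  · refine iSup₂_le fun p hp => ?_
    rcases hp.1 with rfl | h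
    · simp
    · exact le_max_of_le_right (le_iSup₂ (f := fun (p : ℝ × ℝ) (_ : p ∈ {p : ℝ × ℝ |
        p ∈ A ∧ 0 ≤ p.1 ∧ p.1 ≤ t}) => ENNReal.ofReal (p.2 - b * (t - p.1))) p ⟨h, hp.2⟩)
  · refine max_le ?_ ?_
    · have := le_iSup₂ (f := fun (p : ℝ × ℝ) (_ : p ∈ {p : ℝ × ℝ |
        p ∈ insert ((0 : ℝ), (x : ℝ)) A ∧ 0 ≤ p.1 ∧ p.1 ≤ t}) =>
        ENNReal.ofReal (p.2 - b * (t - p.1))) (0, (x : ℝ)) ⟨mem_insert _ _, le_rfl, t.2⟩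
      simpa [process] using this
    · exact biSup_mono fun p hp => ⟨mem_insert_of_mem _ hp.1, hp.2⟩

theorem sigmaFinite_of_tail {μ : Measure ℝ} (hμ_pos : μ (Iic 0) = 0)
    (hμ_tail : ∀ x : ℝ, 0 < x → μ (Ici x) < ∞) : SigmaFinite μ := by
  refine ⟨⟨⟨fun n => Iic 0 ∪ Ici (1 / ((n : ℝ) + 1)), fun _ => trivial, fun n => ?_, ?_⟩⟩⟩
  · refine (measure_union_le _ _).trans_lt ?_
    rw [hμ_pos, zero_add]
    exact hμ_tail _ (by positivity)
  · refine eq_univ_of_forall fun x => mem_iUnion.2 ?_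
    rcases le_or_gt x 0 with h | h
    · exact ⟨0, Or.inl h⟩
    · obtain ⟨n, hn⟩ := exists_nat_one_div_lt h
      exact ⟨n, Or.inr hn.le⟩

section Tail

theorem measurable_measure_Ioi (μ : Measure ℝ) : Measurable fun y => μ (Ioi y) :=
  Antitone.measurable fun _ _ h => measure_mono (Ioi_subset_Ioi h)

theorem meanExceed_add (μ : Measure ℝ) (b : ℝ) (s t : ℝ≥0) (y : ℝ) :
    meanExceed μ b (s + t) y = meanExceed μ b s (y + b * t) + meanExceed μ b t y := by
  have hs : (0 : ℝ) ≤ s := s.2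
  have ht : (0 : ℝ) ≤ t := t.2
  unfold meanExceed
  have hU : Icc (0 : ℝ) ((s + t : ℝ≥0) : ℝ) = Icc 0 (s : ℝ) ∪ Ioc (s : ℝ) (s + t) := by
    rw [NNReal.coe_add, Icc_union_Ioc_eq_Icc hs (by linarith)]
  rw [hU, lintegral_union measurableSet_Ioc]
  · congr 1
    · refine lintegral_congr fun r => ?_
      push_cast
      congr 2
      ring
    · rw [setLIntegral_congr (Ioc_ae_eq_Icc (α := ℝ) (μ := volume))]
      have hmp : MeasurePreserving (fun r : ℝ => (s : ℝ) + r) volume volume :=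
        measurePreserving_add_left volume (s : ℝ)
      have := hmp.setLIntegral_comp_preimage_emb (measurableEmbedding_addLeft (s : ℝ))
        (fun r => μ (Ioi (y + b * (((s + t : ℝ≥0) : ℝ) - r)))) (Icc (s : ℝ) (s + t))
      rw [← this]
      have hpre : (fun r : ℝ => (s : ℝ) + r) ⁻¹' Icc (s : ℝ) (s + t) = Icc 0 (t : ℝ) := by
        ext r; simp
      rw [hpre]
      refine lintegral_congr fun r => ?_
      push_cast
      congr 2
      ring
  · rw [Set.disjoint_left]
    intro a ha hb
    exact absurd hb.1 (not_lt.2 ha.2)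

theorem meanExceed_le (μ : Measure ℝ) {b c : ℝ} (hc : 0 ≤ c) (hbc : -b ≤ c) (t : ℝ≥0) (y : ℝ) :
    meanExceed μ b t y ≤ t * μ (Ioi (y - c * t)) := by
  unfold meanExceed
  calc _ ≤ ∫⁻ r in Icc (0 : ℝ) t, μ (Ioi (y - c * t)) := by
        refine setLIntegral_mono' measurableSet_Icc fun r hr => measure_mono (Ioi_subset_Ioi ?_)
        nlinarith [mul_nonneg hc hr.1, mul_nonneg (by linarith : 0 ≤ c + b) (sub_nonneg.2 hr.2)]
    _ = _ := by
        rw [setLIntegral_const, Real.volume_Icc, mul_comm, sub_zero, ENNReal.ofReal_coe_nnreal]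

theorem le_meanExceed (μ : Measure ℝ) {b c : ℝ} (hc : 0 ≤ c) (hbc : b ≤ c) (t : ℝ≥0) (y : ℝ) :
    t * μ (Ioi (y + c * t)) ≤ meanExceed μ b t y := by
  unfold meanExceed
  calc _ = ∫⁻ r in Icc (0 : ℝ) t, μ (Ioi (y + c * t)) := by
        rw [setLIntegral_const, Real.volume_Icc, mul_comm, sub_zero, ENNReal.ofReal_coe_nnreal]
    _ ≤ _ := by
        refine setLIntegral_mono' measurableSet_Icc fun r hr => measure_mono (Ioi_subset_Ioi ?_)
        nlinarith [mul_nonneg hc hr.1, mul_nonneg (by linarith : 0 ≤ c - b) (sub_nonneg.2 hr.2)]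

theorem tendsto_measure_Ioi_atTop {μ : Measure ℝ} (hμ_tail : ∀ x : ℝ, 0 < x → μ (Ici x) < ∞) :
    Tendsto (fun y => μ (Ioi y)) atTop (𝓝 0) := by
  have h := tendsto_measure_iInter_atTop (μ := μ) (s := fun y : ℝ => Ioi y)
    (fun i => measurableSet_Ioi.nullMeasurableSet) (fun _ _ h => Ioi_subset_Ioi h)
    ⟨1, ((measure_mono Ioi_subset_Ici_self).trans_lt (hμ_tail 1 one_pos)).ne⟩
  have : (⋂ y : ℝ, Ioi y) = ∅ := by
    refine eq_empty_of_forall_notMem fun x hx => ?_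
    exact absurd (mem_Ioi.1 (mem_iInter.1 hx x)) (lt_irrefl x)
  rw [this, measure_empty] at h
  exact h

theorem tendsto_meanExceed_atTop {μ : Measure ℝ} (hμ_tail : ∀ x : ℝ, 0 < x → μ (Ici x) < ∞)
    (b : ℝ) (t : ℝ≥0) : Tendsto (meanExceed μ b t) atTop (𝓝 0) := by
  have h : Tendsto (fun y => (t : ℝ≥0∞) * μ (Ioi (y - |b| * t))) atTop (𝓝 0) := by
    have h1 := (tendsto_measure_Ioi_atTop hμ_tail).comp
      (tendsto_atTop_add_const_right atTop (-(|b| * t)) tendsto_id)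
    have := ENNReal.Tendsto.const_mul (a := (t : ℝ≥0∞)) h1 (Or.inr ENNReal.coe_ne_top)
    simpa [sub_eq_add_neg, Function.comp_def] using this
  exact tendsto_of_tendsto_of_tendsto_of_le_of_le tendsto_const_nhds h (fun _ => zero_le)
    fun y => meanExceed_le μ (abs_nonneg b) (neg_le_abs b) t y

end Tail

theorem measurableSet_exceed (b : ℝ) (t : ℝ≥0) (y : ℝ) :
    MeasurableSet {p : ℝ × ℝ | 0 ≤ p.1 ∧ p.1 ≤ t ∧ y < p.2 - b * (t - p.1)} := by
  have h : Measurable fun p : ℝ × ℝ => p.2 - b * (t - p.1) := by fun_prop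
  exact (measurableSet_le measurable_const measurable_fst).inter
    ((measurableSet_le measurable_fst measurable_const).inter
      (measurableSet_lt measurable_const h))

theorem intensity_exceed (μ : Measure ℝ) [SFinite μ] (b : ℝ) (t : ℝ≥0) (y : ℝ) :
    intensity μ {p : ℝ × ℝ | 0 ≤ p.1 ∧ p.1 ≤ t ∧ y < p.2 - b * (t - p.1)} =
      meanExceed μ b t y := by
  unfold intensity meanExceed
  rw [Measure.prod_apply (measurableSet_exceed b t y),
    ← lintegral_indicator measurableSet_Ici, ← lintegral_indicator measurableSet_Icc]
  refine lintegral_congr fun s => ?_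
  by_cases hs : s ∈ Icc (0 : ℝ) t
  · rw [indicator_of_mem hs, indicator_of_mem (mem_Ici.2 hs.1)]
    congr 1
    ext ξ
    simp only [mem_preimage, mem_ofPred_eq, mem_Ioi]
    exact ⟨fun h => by linarith [h.2.2], fun h => ⟨hs.1, hs.2, by linarith⟩⟩
  · rw [indicator_of_notMem hs]
    by_cases h0 : s ∈ Ici (0 : ℝ)
    · rw [indicator_of_mem h0]
      convert measure_empty (μ := μ)
      refine eq_empty_of_forall_notMem fun ξ hξ => hs ⟨hξ.1, hξ.2.1⟩
    · rw [indicator_of_notMem h0]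

theorem noise_le_iff (b : ℝ) (A : Set (ℝ × ℝ)) (t y : ℝ≥0) :
    noise b A t ≤ y ↔
      (A ∩ {p : ℝ × ℝ | 0 ≤ p.1 ∧ p.1 ≤ t ∧ (y : ℝ) < p.2 - b * (t - p.1)}).encard = 0 := by
  rw [Set.encard_eq_zero, noise, iSup₂_le_iff, eq_empty_iff_forall_notMem]
  refine forall_congr' fun p => ?_
  have : ENNReal.ofReal (p.2 - b * (t - p.1)) ≤ y ↔ p.2 - b * (t - p.1) ≤ y := by
    rw [ENNReal.ofReal_le_iff_le_toReal ENNReal.coe_ne_top, ENNReal.coe_toReal]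
  rw [this]
  simp only [mem_ofPred_eq, mem_inter_iff]
  constructor
  · rintro h ⟨h1, h2, h3, h4⟩
    exact absurd (h ⟨h1, h2, h3⟩) (not_le.2 h4)
  · rintro h ⟨h1, h2, h3⟩
    exact not_lt.1 fun h4 => h ⟨h1, h2, h3, h4⟩

section Law

variable {Ω : Type*} [MeasurableSpace Ω] {P : Measure Ω} {μ : Measure ℝ} {S : Ω → Set (ℝ × ℝ)}

theorem nullMeasurableSet_noise_le (hS : IsPoissonPointProcess P S (intensity μ)) (b : ℝ)
    (t y : ℝ≥0) : NullMeasurableSet {ω | noise b (S ω) t ≤ y} P := by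
  simp only [noise_le_iff]
  exact (hS.hasLaw _ (measurableSet_exceed b t y)).aemeasurable.nullMeasurableSet_preimage
    (measurableSet_singleton 0)

theorem measure_noise_le [SFinite μ] (hS : IsPoissonPointProcess P S (intensity μ)) (b : ℝ)
    (t y : ℝ≥0) : P {ω | noise b (S ω) t ≤ y} = poissonLaw (meanExceed μ b t y) {0} := by
  simp only [noise_le_iff]
  rw [(hS.hasLaw _ (measurableSet_exceed b t y)).measure_eq (p := fun n => n = 0)
    (measurableSet_singleton 0), intensity_exceed]
  rfl

theorem aemeasurable_noise (hS : IsPoissonPointProcess P S (intensity μ)) (b : ℝ) (t : ℝ≥0) :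
    AEMeasurable (fun ω => noise b (S ω) t) P := by
  have : NullMeasurable (fun ω => noise b (S ω) t) P := by
    refine @measurable_of_Iic ℝ≥0∞ (NullMeasurableSpace Ω P) _ _ _ _ _ _ _ _ fun y => ?_
    induction y with
    | top =>
      rw [Iic_top]
      exact MeasurableSet.univ
    | coe y => exact nullMeasurableSet_noise_le hS b t y
  exact this.aemeasurable

theorem noise_lt_top [SFinite μ] [IsProbabilityMeasure P]
    (hμ_tail : ∀ x : ℝ, 0 < x → μ (Ici x) < ∞)
    (hS : IsPoissonPointProcess P S (intensity μ)) (b : ℝ) (t : ℝ≥0) :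
    ∀ᵐ ω ∂P, noise b (S ω) t < ∞ := by
  have h : ∀ n : ℕ, P {ω | ¬ noise b (S ω) t < ∞} ≤ meanExceed μ b t (n : ℝ) := by
    intro n
    refine le_trans ?_ (one_sub_poissonLaw_le _)
    have := measure_noise_le hS b t n
    rw [NNReal.coe_natCast] at this
    rw [← this, ← prob_compl_eq_one_sub₀ (nullMeasurableSet_noise_le hS b t n)]
    refine measure_mono fun ω hω h => hω ?_
    exact lt_of_le_of_lt h ENNReal.coe_lt_top
  have hlim := (tendsto_meanExceed_atTop hμ_tail b t).comp tendsto_natCast_atTop_atTop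
  exact le_antisymm (ge_of_tendsto' hlim h) zero_le

/-- The law of the contribution at time `t` of the atoms of the point process. -/
noncomputable def noiseLaw (P : Measure Ω) (b : ℝ) (S : Ω → Set (ℝ × ℝ)) (t : ℝ≥0) : Measure ℝ :=
  P.map fun ω => (noise b (S ω) t).toReal

theorem noiseLaw_Iio_zero (hS : IsPoissonPointProcess P S (intensity μ)) (b : ℝ) (t : ℝ≥0) :
    noiseLaw P b S t (Iio 0) = 0 := by
  rw [noiseLaw, Measure.map_apply_of_aemeasurable (aemeasurable_noise hS b t).ennreal_toReal
    measurableSet_Iio]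
  convert measure_empty (μ := P)
  exact eq_empty_of_forall_notMem fun ω hω => absurd ENNReal.toReal_nonneg (not_le.2 hω)

theorem isProbabilityMeasure_noiseLaw [IsProbabilityMeasure P]
    (hS : IsPoissonPointProcess P S (intensity μ)) (b : ℝ) (t : ℝ≥0) :
    IsProbabilityMeasure (noiseLaw P b S t) :=
  Measure.isProbabilityMeasure_map (aemeasurable_noise hS b t).ennreal_toReal

theorem noiseLaw_Iic [SFinite μ] [IsProbabilityMeasure P]
    (hμ_tail : ∀ x : ℝ, 0 < x → μ (Ici x) < ∞)
    (hS : IsPoissonPointProcess P S (intensity μ)) (b : ℝ) (t : ℝ≥0) {y : ℝ} (hy : 0 ≤ y) :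
    noiseLaw P b S t (Iic y) = poissonLaw (meanExceed μ b t y) {0} := by
  lift y to ℝ≥0 using hy
  rw [← measure_noise_le hS b t y, noiseLaw,
    Measure.map_apply_of_aemeasurable (aemeasurable_noise hS b t).ennreal_toReal measurableSet_Iic]
  refine measure_congr ?_
  filter_upwards [noise_lt_top hμ_tail hS b t] with ω hω
  refine propext ?_
  change (noise b (S ω) t).toReal ≤ y ↔ noise b (S ω) t ≤ y
  rw [← ENNReal.coe_toReal, ENNReal.toReal_le_toReal hω.ne ENNReal.coe_ne_top]

theorem semigroup_eq_integral [SFinite μ] [IsProbabilityMeasure P]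
    (hμ_tail : ∀ x : ℝ, 0 < x → μ (Ici x) < ∞)
    (hS : IsPoissonPointProcess P S (intensity μ)) (b : ℝ) (t : ℝ≥0) (f : C₀(ℝ≥0, ℝ)) (x : ℝ≥0) :
    semigroup P b S t f x = ∫ z, toRealFun f (max (x - b * t) z) ∂noiseLaw P b S t := by
  have hcont : Continuous (toRealFun f) := f.continuous.comp continuous_real_toNNReal
  rw [noiseLaw, integral_map (aemeasurable_noise hS b t).ennreal_toReal
    (by fun_prop), semigroup]
  refine integral_congr_ae ?_
  filter_upwards [noise_lt_top hμ_tail hS b t] with ω hω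
  lift noise b (S ω) t to ℝ≥0 using hω.ne with z hz
  rw [process_eq_max, ← hz, toRealFun, Real.toNNReal_monotone.map_max, ENNReal.ofReal,
    ← ENNReal.coe_max, ENNReal.toNNReal_coe, ENNReal.coe_toReal, Real.toNNReal_coe]

end Law

end ESN

namespace ESN

/-! ### The transition operators on `C₀(ℝ≥0, ℝ)` -/

section ToRealFun

variable (f : C₀(ℝ≥0, ℝ))

theorem norm_le_iff_forall_abs_le {C : ℝ} (hC : 0 ≤ C) : ‖f‖ ≤ C ↔ ∀ x, |f x| ≤ C := by
  rw [← ZeroAtInftyContinuousMap.norm_toBCF_eq_norm, BoundedContinuousFunction.norm_le hC]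
  rfl

theorem abs_apply_le_norm (x : ℝ≥0) : |f x| ≤ ‖f‖ :=
  (norm_le_iff_forall_abs_le f (norm_nonneg f)).1 le_rfl x

theorem continuous_toRealFun : Continuous (toRealFun f) :=
  f.continuous.comp continuous_real_toNNReal

theorem abs_toRealFun_le (x : ℝ) : |toRealFun f x| ≤ ‖f‖ := abs_apply_le_norm f _

theorem toRealFun_coe (x : ℝ≥0) : toRealFun f x = f x := by
  rw [toRealFun, Real.toNNReal_coe]

theorem toRealFun_of_nonpos {x : ℝ} (hx : x ≤ 0) : toRealFun f x = f 0 := by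
  rw [toRealFun, Real.toNNReal_of_nonpos hx]

theorem uniformContinuous_toRealFun : UniformContinuous (toRealFun f) :=
  (ZeroAtInftyContinuousMap.uniformContinuous f).comp Real.lipschitzWith_toNNReal.uniformContinuous

theorem tendsto_toRealFun_atTop : Tendsto (toRealFun f) atTop (𝓝 0) := by
  have h : Tendsto f atTop (𝓝 0) := by
    rw [← cocompact_eq_atTop]
    exact zero_at_infty f
  exact h.comp tendsto_real_toNNReal_atTop

theorem integrable_toRealFun_comp {E : Type*} [MeasurableSpace E] (ν : Measure E)
    [IsFiniteMeasure ν] {u : E → ℝ} (hu : Measurable u) :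
    Integrable (fun z => toRealFun f (u z)) ν :=
  Integrable.of_bound ((continuous_toRealFun f).measurable.comp hu).aestronglyMeasurable ‖f‖
    (Eventually.of_forall fun z => abs_toRealFun_le f (u z))

end ToRealFun

/-- The operator `f ↦ (x ↦ ∫ f(max (x - b t) z) ρ(dz))`. -/
noncomputable def transition (b : ℝ) (t : ℝ≥0) (ρ : Measure ℝ) [IsFiniteMeasure ρ] :
    C₀(ℝ≥0, ℝ) →ₗ[ℝ] C₀(ℝ≥0, ℝ) where
  toFun f :=
    { toFun := fun x => ∫ z, toRealFun f (max (x - b * t) z) ∂ρ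
      continuous_toFun := by
        refine continuous_of_dominated (bound := fun _ => ‖f‖) (fun x => ?_)
          (fun x => Eventually.of_forall fun z => abs_toRealFun_le f _) (integrable_const _)
          (Eventually.of_forall fun z => ?_)
        · exact (integrable_toRealFun_comp f ρ (by fun_prop)).aestronglyMeasurable
        · exact (continuous_toRealFun f).comp (by fun_prop)
      zero_at_infty' := by
        rw [cocompact_eq_atTop]
        have h0 : (0 : ℝ) = ∫ _z : ℝ, (0 : ℝ) ∂ρ := by simp
        rw [h0]
        refine tendsto_integral_filter_of_dominated_convergence (fun _ => ‖f‖)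
          (Eventually.of_forall fun x =>
            (integrable_toRealFun_comp f ρ (by fun_prop)).aestronglyMeasurable)
          (Eventually.of_forall fun x => Eventually.of_forall fun z => abs_toRealFun_le f _)
          (integrable_const _) (Eventually.of_forall fun z => ?_)
        refine (tendsto_toRealFun_atTop f).comp ?_
        refine tendsto_atTop_mono (fun x => le_max_left _ _) ?_
        exact tendsto_atTop_add_const_right _ _ (NNReal.tendsto_coe_atTop.2 tendsto_id) }
  map_add' f g := by
    ext x
    exact integral_add (integrable_toRealFun_comp f ρ (by fun_prop))
      (integrable_toRealFun_comp g ρ (by fun_prop))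
  map_smul' c f := by
    ext x
    exact integral_const_mul c _

theorem transition_apply (b : ℝ) (t : ℝ≥0) (ρ : Measure ℝ) [IsFiniteMeasure ρ] (f : C₀(ℝ≥0, ℝ))
    (x : ℝ≥0) : transition b t ρ f x = ∫ z, toRealFun f (max (x - b * t) z) ∂ρ := rfl

/-- A family of laws on `[0, ∞)` whose distribution functions are the void probabilities of the
noise. -/
structure IsNoiseFamily (μ : Measure ℝ) (b : ℝ) (ρ : ℝ≥0 → Measure ℝ) : Prop where
  isProbabilityMeasure : ∀ t, IsProbabilityMeasure (ρ t)
  Iio_zero : ∀ t, ρ t (Iio 0) = 0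
  measure_Iic : ∀ t y, 0 ≤ y → ρ t (Iic y) = poissonLaw (meanExceed μ b t y) {0}

namespace IsNoiseFamily

variable {μ : Measure ℝ} {b : ℝ} {ρ : ℝ≥0 → Measure ℝ}

theorem ae_nonneg (hρ : IsNoiseFamily μ b ρ) (t : ℝ≥0) : ∀ᵐ z ∂ρ t, 0 ≤ z := by
  have : {z : ℝ | ¬ 0 ≤ z} = Iio 0 := by ext; simp
  rw [ae_iff, this, hρ.Iio_zero]

theorem measure_Ioi_le (hρ : IsNoiseFamily μ b ρ) (t : ℝ≥0) {y : ℝ} (hy : 0 ≤ y) :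
    ρ t (Ioi y) ≤ meanExceed μ b t y := by
  have := hρ.isProbabilityMeasure t
  rw [← compl_Iic, prob_compl_eq_one_sub measurableSet_Iic, hρ.measure_Iic t y hy]
  exact one_sub_poissonLaw_le _

theorem map_prod_eq (hρ : IsNoiseFamily μ b ρ) (s t : ℝ≥0) (x : ℝ≥0) :
    ((ρ s).prod (ρ t)).map (fun p => max (max (x - b * s) p.1 - b * t) p.2) =
      (ρ (s + t)).map (fun z => max (x - b * (s + t : ℝ≥0)) z) := by
  have h1 := hρ.isProbabilityMeasure
  have hm1 : Measurable fun p : ℝ × ℝ => max (max (x - b * s) p.1 - b * t) p.2 := by fun_prop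
  have hm2 : Measurable fun z : ℝ => max (x - b * (s + t : ℝ≥0)) z := by fun_prop
  have := Measure.isProbabilityMeasure_map (μ := (ρ s).prod (ρ t)) hm1.aemeasurable
  have := Measure.isProbabilityMeasure_map (μ := ρ (s + t)) hm2.aemeasurable
  refine Measure.ext_of_Iic _ _ fun y => ?_
  rw [Measure.map_apply hm1 measurableSet_Iic, Measure.map_apply hm2 measurableSet_Iic]
  by_cases hxy : x - b * (s + t : ℝ≥0) ≤ y
  · have e1 : (fun p : ℝ × ℝ => max (max (x - b * s) p.1 - b * t) p.2) ⁻¹' Iic y =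
        Iic (y + b * t) ×ˢ Iic y := by
      ext p
      push_cast at hxy
      simp only [mem_preimage, mem_Iic, max_le_iff, mem_prod, sub_le_iff_le_add]
      constructor
      · rintro ⟨⟨-, h⟩, h'⟩
        exact ⟨h, h'⟩
      · rintro ⟨h, h'⟩
        exact ⟨⟨by linarith, h⟩, h'⟩
    have e2 : (fun z : ℝ => max (x - b * (s + t : ℝ≥0)) z) ⁻¹' Iic y = Iic y := by
      ext z
      rw [mem_preimage, mem_Iic, max_le_iff, mem_Iic, and_iff_right hxy]
    rw [e1, e2, Measure.prod_prod]
    rcases lt_or_ge y 0 with hy | hy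
    · have : ∀ r, ρ r (Iic y) = 0 := fun r =>
        measure_mono_null (Iic_subset_Iio.2 hy) (hρ.Iio_zero r)
      rw [this, this, mul_zero]
    · have hy' : 0 ≤ y + b * t := by
        rcases le_or_gt 0 b with hb | hb
        · positivity
        · push_cast at hxy
          nlinarith [x.2, s.2, t.2, mul_nonneg (neg_nonneg.2 hb.le) s.2]
      rw [hρ.measure_Iic _ _ hy, hρ.measure_Iic _ _ hy, hρ.measure_Iic _ _ hy', meanExceed_add,
        poissonLaw_add_singleton_zero]
  · have e1 : (fun p : ℝ × ℝ => max (max (x - b * s) p.1 - b * t) p.2) ⁻¹' Iic y = ∅ := by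
      refine eq_empty_of_forall_notMem fun p hp => hxy ?_
      have h : x - b * s - b * t ≤ y :=
        (sub_le_sub_right (le_max_left _ _) _).trans ((le_max_left _ _).trans hp)
      push_cast
      linarith
    have e2 : (fun z : ℝ => max (x - b * (s + t : ℝ≥0)) z) ⁻¹' Iic y = ∅ :=
      eq_empty_of_forall_notMem fun z hz => hxy ((le_max_left _ _).trans hz)
    rw [e1, e2, measure_empty, measure_empty]

theorem transition_add [∀ t, IsProbabilityMeasure (ρ t)] (hρ : IsNoiseFamily μ b ρ) (s t : ℝ≥0)
    (f : C₀(ℝ≥0, ℝ)) :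
    transition b (s + t) (ρ (s + t)) f = transition b s (ρ s) (transition b t (ρ t) f) := by
  ext x
  have hm1 : Measurable fun p : ℝ × ℝ => max (max (x - b * s) p.1 - b * t) p.2 := by fun_prop
  have hm2 : Measurable fun z : ℝ => max (x - b * (s + t : ℝ≥0)) z := by fun_prop
  have hF := (continuous_toRealFun f).aestronglyMeasurable (μ := (ρ (s + t)).map
    (fun z => max (x - b * (s + t : ℝ≥0)) z))
  rw [transition_apply, transition_apply, ← integral_map hm2.aemeasurable hF, ← hρ.map_prod_eq,
    integral_map hm1.aemeasurable (continuous_toRealFun f).aestronglyMeasurable,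
    integral_prod _ (integrable_toRealFun_comp f _ hm1)]
  refine integral_congr_ae ?_
  filter_upwards [hρ.ae_nonneg s] with z hz
  rw [toRealFun, transition_apply, Real.coe_toNNReal _ (le_max_of_le_right hz)]

theorem norm_transition_le [∀ t, IsProbabilityMeasure (ρ t)] (t : ℝ≥0) (f : C₀(ℝ≥0, ℝ)) :
    ‖transition b t (ρ t) f‖ ≤ ‖f‖ := by
  rw [norm_le_iff_forall_abs_le _ (norm_nonneg f)]
  intro x
  have := norm_integral_le_of_norm_le_const (μ := ρ t)
    (f := fun z => toRealFun f (max (x - b * t) z)) (C := ‖f‖)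
    (Eventually.of_forall fun z => abs_toRealFun_le f _)
  rw [probReal_univ, mul_one] at this
  exact this

theorem tendsto_transition [∀ t, IsProbabilityMeasure (ρ t)] (hρ : IsNoiseFamily μ b ρ)
    (hμ_tail : ∀ x : ℝ, 0 < x → μ (Ici x) < ∞) (f : C₀(ℝ≥0, ℝ)) :
    Tendsto (fun t => transition b t (ρ t) f) (𝓝[>] 0) (𝓝 f) := by
  rw [tendsto_iff_norm_sub_tendsto_zero, Metric.tendsto_nhds]
  intro ε hε
  obtain ⟨δ, hδ, hunif⟩ := Metric.uniformContinuous_iff.1 (uniformContinuous_toRealFun f) (ε / 4)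
    (by linarith)
  set η := δ / 2 with hη
  have hη0 : 0 < η := half_pos hδ
  set m := (μ (Ici (η / 2))).toReal with hm
  have hm0 : 0 ≤ m := ENNReal.toReal_nonneg
  have hbt : Tendsto (fun t : ℝ≥0 => |b| * (t : ℝ)) (𝓝[>] 0) (𝓝 0) := by
    have : Tendsto (fun t : ℝ≥0 => |b| * (t : ℝ)) (𝓝 0) (𝓝 (|b| * ((0 : ℝ≥0) : ℝ))) :=
      Continuous.tendsto (by fun_prop) 0
    simpa using this.mono_left nhdsWithin_le_nhds
  have hmt : Tendsto (fun t : ℝ≥0 => 2 * ‖f‖ * (t * m)) (𝓝[>] 0) (𝓝 0) := by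
    have : Tendsto (fun t : ℝ≥0 => 2 * ‖f‖ * (t * m)) (𝓝 0) (𝓝 (2 * ‖f‖ * (((0 : ℝ≥0) : ℝ) * m))) :=
      Continuous.tendsto (by fun_prop) 0
    simpa using this.mono_left nhdsWithin_le_nhds
  filter_upwards [hbt.eventually (gt_mem_nhds (half_pos hη0)),
    hmt.eventually (gt_mem_nhds (show 0 < ε / 4 by linarith))] with t h1 h2
  rw [Real.dist_eq, sub_zero, abs_norm]
  refine lt_of_le_of_lt ((norm_le_iff_forall_abs_le _ (by linarith : 0 ≤ ε / 2)).2 fun x => ?_)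
    (half_lt_self hε)
  have hprob : (ρ t).real (Ioi η) ≤ t * m := by
    rw [Measure.real, hm, ← ENNReal.coe_toReal, ← ENNReal.toReal_mul]
    refine ENNReal.toReal_mono (ENNReal.mul_ne_top ENNReal.coe_ne_top (hμ_tail _
      (half_pos hη0)).ne) ?_
    refine (hρ.measure_Ioi_le t hη0.le).trans ((meanExceed_le μ (abs_nonneg b) (neg_le_abs b) t
      η).trans ?_)
    gcongr
    intro z hz
    have : η - |b| * t < z := hz
    simp only [mem_Ici]
    linarith
  have hpt : ∀ᵐ z ∂ρ t, ‖toRealFun f (max (x - b * t) z) - toRealFun f x‖ ≤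
      ε / 4 + (Ioi η).indicator (fun _ => 2 * ‖f‖) z := by
    filter_upwards [hρ.ae_nonneg t] with z hz
    by_cases hzη : z ∈ Ioi η
    · rw [indicator_of_mem hzη, Real.norm_eq_abs]
      have a1 := abs_sub (toRealFun f (max (x - b * t) z)) (toRealFun f x)
      have a2 := abs_toRealFun_le f (max (x - b * t) z)
      have a3 := abs_toRealFun_le f x
      linarith
    · rw [indicator_of_notMem hzη, add_zero]
      refine (hunif ?_).le
      have hzη' : z ≤ η := not_lt.1 hzη
      have hx : (0 : ℝ) ≤ x := x.2
      have b1 : |b * t| = |b| * t := by rw [abs_mul, NNReal.abs_eq]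
      have b2 := abs_le.1 b1.le
      rw [Real.dist_eq, abs_lt]
      constructor
      · have := le_max_left (x - b * t) z
        linarith [b2.2]
      · have : max (x - b * t) z ≤ x + η := max_le (by linarith [b2.1]) (by linarith)
        linarith
  have hint : Integrable (fun z => ε / 4 + (Ioi η).indicator (fun _ => 2 * ‖f‖) z) (ρ t) :=
    (integrable_const _).add ((integrable_const _).indicator measurableSet_Ioi)
  have hle := norm_integral_le_of_norm_le hint hpt
  rw [integral_sub (integrable_toRealFun_comp f _ (by fun_prop)) (integrable_const _),
    integral_const, integral_add (integrable_const _)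
      ((integrable_const _).indicator measurableSet_Ioi), integral_const,
    integral_indicator measurableSet_Ioi, setIntegral_const] at hle
  simp only [probReal_univ, one_mul, smul_eq_mul] at hle
  rw [ZeroAtInftyContinuousMap.sub_apply, transition_apply, ← toRealFun_coe f x]
  refine hle.trans ?_
  have : (ρ t).real (Ioi η) * (2 * ‖f‖) ≤ 2 * ‖f‖ * (t * m) := by
    rw [mul_comm]
    gcongr
  linarith

theorem isContractionSemigroup [∀ t, IsProbabilityMeasure (ρ t)] (hρ : IsNoiseFamily μ b ρ)
    (hμ_tail : ∀ x : ℝ, 0 < x → μ (Ici x) < ∞) :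
    IsContractionSemigroup fun t => transition b t (ρ t) where
  norm_le t f := norm_transition_le t f
  add_apply s t f := hρ.transition_add s t f
  tendsto_zero f := hρ.tendsto_transition hμ_tail f

end IsNoiseFamily

theorem mem_infinitesimalGraph_iff {b : ℝ} {ρ : ℝ≥0 → Measure ℝ}
    [∀ t, IsProbabilityMeasure (ρ t)] {q : C₀(ℝ≥0, ℝ) × C₀(ℝ≥0, ℝ)} :
    q ∈ infinitesimalGraph (fun t => transition b t (ρ t)) ↔
      TendstoUniformly (fun (t x : ℝ≥0) => (transition b t (ρ t) q.1 x - q.1 x) / (t : ℝ))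
        (fun x => q.2 x) (𝓝[>] 0) := by
  refine ZeroAtInftyContinuousMap.tendsto_iff_tendstoUniformly.trans ?_
  have : (fun (t : ℝ≥0) => ((t : ℝ)⁻¹ • (transition b t (ρ t) q.1 - q.1) : ℝ≥0 → ℝ)) =
      fun (t x : ℝ≥0) => (transition b t (ρ t) q.1 x - q.1 x) / (t : ℝ) := by
    funext t x
    simp [div_eq_inv_mul]
  rw [← this]
  rfl

section Law

variable {Ω : Type*} [MeasurableSpace Ω] {P : Measure Ω} [IsProbabilityMeasure P] {μ : Measure ℝ}
  [SFinite μ] {S : Ω → Set (ℝ × ℝ)}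

theorem isNoiseFamily_noiseLaw (hμ_tail : ∀ x : ℝ, 0 < x → μ (Ici x) < ∞)
    (hS : IsPoissonPointProcess P S (intensity μ)) (b : ℝ) :
    IsNoiseFamily μ b (noiseLaw P b S) where
  isProbabilityMeasure := isProbabilityMeasure_noiseLaw hS b
  Iio_zero := noiseLaw_Iio_zero hS b
  measure_Iic t _ hy := noiseLaw_Iic hμ_tail hS b t hy

theorem generatorGraph_eq (hμ_tail : ∀ x : ℝ, 0 < x → μ (Ici x) < ∞)
    (hS : IsPoissonPointProcess P S (intensity μ)) (b : ℝ)
    [∀ t, IsProbabilityMeasure (noiseLaw P b S t)] :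
    generatorGraph (semigroup P b S) =
      infinitesimalGraph fun t => transition b t (noiseLaw P b S t) := by
  ext q
  rw [mem_infinitesimalGraph_iff]
  simp only [generatorGraph, mem_ofPred_eq, semigroup_eq_integral hμ_tail hS, transition_apply]

end Law

end ESN

/-! ### Integration by parts against a measure and shifts of tails -/

section Calculus

variable {F φ : ℝ → ℝ}

theorem integrableOn_min_sub_and_integral_eq (hF : ∀ x, HasDerivAt F (φ x) x) (hφ : Continuous φ)
    (ρ : Measure ℝ) [SFinite ρ] {w K : ℝ} (hwK : w ≤ K)
    (hfin : ∫⁻ v in Ioc w K, ‖φ v‖ₑ * ρ (Ioi v) < ∞) :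
    IntegrableOn (fun y => F (min y K) - F w) (Ioi w) ρ ∧
      ∫ y in Ioi w, (F (min y K) - F w) ∂ρ = ∫ v in Ioc w K, φ v * ρ.real (Ioi v) := by
  set G : ℝ × ℝ → ℝ := {p : ℝ × ℝ | p.1 < p.2}.indicator fun p => φ p.1 with hG
  have hGm : Measurable G :=
    (hφ.measurable.comp measurable_fst).indicator (measurableSet_lt measurable_fst measurable_snd)
  have hGv : ∀ v y, G (v, y) = (Ioi v).indicator (fun _ => φ v) y := fun v y => by
    simp only [hG, indicator, mem_ofPred_eq, mem_Ioi]
  have hGy : ∀ v y, G (v, y) = (Iio y).indicator φ v := fun v y => by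
    simp only [hG, indicator, mem_ofPred_eq, mem_Iio]
  have hinter : ∀ v ∈ Ioc w K, Ioi v ∩ Ioi w = Ioi v := fun v hv =>
    inter_eq_left.2 (Ioi_subset_Ioi hv.1.le)
  have hGint : Integrable G ((volume.restrict (Ioc w K)).prod (ρ.restrict (Ioi w))) := by
    refine ⟨hGm.aestronglyMeasurable, ?_⟩
    rw [hasFiniteIntegral_iff_enorm, lintegral_prod _ (hGm.enorm.aemeasurable)]
    refine lt_of_eq_of_lt ?_ hfin
    refine setLIntegral_congr_fun measurableSet_Ioc fun v hv => ?_
    have : ∀ y, ‖G (v, y)‖ₑ = (Ioi v).indicator (fun _ => ‖φ v‖ₑ) y := fun y => by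
      rw [hGv, enorm_indicator_eq_indicator_enorm]
    simp only [this]
    rw [lintegral_indicator measurableSet_Ioi, Measure.restrict_restrict measurableSet_Ioi,
      hinter v hv, setLIntegral_const]
  have hinner : ∀ y ∈ Ioi w, ∫ v in Ioc w K, G (v, y) = F (min y K) - F w := by
    intro y hy
    have hy' : w < y := hy
    simp only [hGy]
    rw [integral_indicator measurableSet_Iio, Measure.restrict_restrict measurableSet_Iio]
    have hle : w ≤ min y K := le_min hy'.le hwK
    rw [← intervalIntegral.integral_eq_sub_of_hasDerivAt (fun x _ => hF x)
      (hφ.intervalIntegrable _ _), intervalIntegral.integral_of_le hle]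
    refine setIntegral_congr_set ?_
    have h1 : (Ioc w (min y K) : Set ℝ) = Iic y ∩ Ioc w K := by
      ext v; simp only [mem_Ioc, mem_inter_iff, mem_Iic, le_min_iff]; tauto
    rw [h1]
    exact Iio_ae_eq_Iic.inter (ae_eq_refl _)
  refine ⟨?_, ?_⟩
  · refine hGint.integral_prod_right.congr ?_
    filter_upwards [ae_restrict_mem measurableSet_Ioi] with y hy using hinner y hy
  · rw [← setIntegral_congr_fun measurableSet_Ioi hinner]
    have := integral_integral_swap (f := fun v y => G (v, y)) (μ := volume.restrict (Ioc w K))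
      (ν := ρ.restrict (Ioi w)) hGint
    rw [← this]
    refine setIntegral_congr_fun measurableSet_Ioc fun v hv => ?_
    simp only [hGv]
    rw [integral_indicator measurableSet_Ioi, Measure.restrict_restrict measurableSet_Ioi,
      hinter v hv, setIntegral_const, smul_eq_mul, mul_comm]

theorem integrableOn_sub_of_bounded {C : ℝ} (hF : Continuous F) (hC : ∀ x, |F x| ≤ C)
    {ρ : Measure ℝ} {K : ℝ} (hK : ρ (Ioi K) < ∞) (a : ℝ) :
    IntegrableOn (fun y => F y - a) (Ioi K) ρ := by
  refine Measure.integrableOn_of_bounded (M := C + |a|) hK.ne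
    (hF.sub continuous_const).aestronglyMeasurable (Eventually.of_forall fun y => ?_)
  exact (abs_sub _ _).trans (add_le_add_left (hC y) _)

theorem integrableOn_sub_and_integral_eq {C : ℝ} (hF : ∀ x, HasDerivAt F (φ x) x)
    (hφ : Continuous φ) (hC : ∀ x, |F x| ≤ C) (ρ : Measure ℝ) [SFinite ρ] {w K : ℝ} (hwK : w ≤ K)
    (hfin : ∫⁻ v in Ioc w K, ‖φ v‖ₑ * ρ (Ioi v) < ∞) (hK : ρ (Ioi K) < ∞) :
    IntegrableOn (fun y => F y - F w) (Ioi w) ρ ∧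
      ∫ y in Ioi w, (F y - F w) ∂ρ =
        (∫ v in Ioc w K, φ v * ρ.real (Ioi v)) + ∫ y in Ioi K, (F y - F K) ∂ρ := by
  obtain ⟨h1, h2⟩ := integrableOn_min_sub_and_integral_eq hF hφ ρ hwK hfin
  have hFc : Continuous F := continuous_iff_continuousAt.2 fun x => (hF x).continuousAt
  have h3 := integrableOn_sub_of_bounded hFc hC hK (F K)
  have h4 : IntegrableOn ((Ioi K).indicator fun y => F y - F K) (Ioi w) ρ :=
    ((integrable_indicator_iff measurableSet_Ioi).2 h3).integrableOn
  have heq : (fun y => F y - F w) =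
      fun y => (F (min y K) - F w) + (Ioi K).indicator (fun y => F y - F K) y := by
    funext y
    by_cases hy : y ∈ Ioi K
    · rw [indicator_of_mem hy, min_eq_right (le_of_lt hy)]; ring
    · rw [indicator_of_notMem hy, min_eq_left (not_lt.1 hy)]; ring
  rw [heq]
  refine ⟨h1.add h4, ?_⟩
  rw [integral_add h1 h4, h2, integral_indicator measurableSet_Ioi,
    Measure.restrict_restrict measurableSet_Ioi, inter_eq_left.2 (Ioi_subset_Ioi hwK)]

theorem norm_integral_Ioi_sub_le {C : ℝ} {ρ : Measure ℝ} {K : ℝ} (hC : ∀ x, K ≤ x → |F x| ≤ C)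
    (hK : ρ (Ioi K) < ∞) :
    |∫ y in Ioi K, (F y - F K) ∂ρ| ≤ 2 * C * ρ.real (Ioi K) := by
  refine norm_setIntegral_le_of_norm_le_const (f := fun y => F y - F K) hK fun y hy => ?_
  have h1 := hC y (le_of_lt hy)
  have h2 := hC K le_rfl
  exact (abs_sub _ _).trans (by linarith)

theorem intervalIntegrable_of_bounded {n : ℝ → ℝ} {C : ℝ} (hn : Measurable n)
    (h0 : ∀ v, 0 ≤ n v) (hC : ∀ v, n v ≤ C) (α β : ℝ) : IntervalIntegrable n volume α β := by
  rw [intervalIntegrable_iff]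
  refine Measure.integrableOn_of_bounded (M := C) (by simp) hn.aestronglyMeasurable
    (Eventually.of_forall fun v => ?_)
  rw [Real.norm_of_nonneg (h0 v)]
  exact hC v

theorem integral_shift_sub_shift_le {n : ℝ → ℝ} {C : ℝ} (hn : Measurable n)
    (h0 : ∀ v, 0 ≤ n v) (hC : ∀ v, n v ≤ C) {a d : ℝ} (ha : 0 ≤ a) (hd : 0 ≤ d) (α β : ℝ) :
    ∫ v in α..β, (n (v - a) - n (v + d)) ≤ (a + d) * C := by
  have hi := intervalIntegrable_of_bounded hn h0 hC
  have hi1 : IntervalIntegrable (fun v => n (v - a)) volume α β :=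
    intervalIntegrable_of_bounded (hn.comp (measurable_id.sub_const a)) (fun v => h0 _)
      (fun v => hC _) α β
  have hi2 : IntervalIntegrable (fun v => n (v + d)) volume α β :=
    intervalIntegrable_of_bounded (hn.comp (measurable_id.add_const d)) (fun v => h0 _)
      (fun v => hC _) α β
  rw [intervalIntegral.integral_sub hi1 hi2, intervalIntegral.integral_comp_sub_right,
    intervalIntegral.integral_comp_add_right,
    ← intervalIntegral.integral_add_adjacent_intervals (hi (α - a) (α + d)) (hi (α + d) (β - a)),
    ← intervalIntegral.integral_add_adjacent_intervals (hi (α + d) (β - a)) (hi (β - a) (β + d))]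
  have h1 : ∫ v in (α - a)..(α + d), n v ≤ (a + d) * C := by
    have := intervalIntegral.integral_mono_on (by linarith) (hi (α - a) (α + d))
      (intervalIntegrable_const (c := C)) fun v _ => hC v
    rw [intervalIntegral.integral_const, smul_eq_mul] at this
    linarith
  have h2 : 0 ≤ ∫ v in (β - a)..(β + d), n v :=
    intervalIntegral.integral_nonneg (by linarith) fun v _ => h0 v
  linarith

end Calculus

namespace ESN

/-! ### The functions of `C10` with vanishing derivative at the origin -/

/-- `φ` is the derivative of `f`, extended by `0` to the negative half-line. -/
structure HasNiceDeriv (f : C₀(ℝ≥0, ℝ)) (φ : ℝ → ℝ) : Prop where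
  continuous : Continuous φ
  eq_zero_of_nonpos : ∀ x ≤ 0, φ x = 0
  tendsto_zero : Tendsto φ atTop (𝓝 0)
  hasDerivAt : ∀ x, HasDerivAt (toRealFun f) (φ x) x

namespace HasNiceDeriv

variable {f : C₀(ℝ≥0, ℝ)} {φ : ℝ → ℝ}

theorem deriv₀_eq (h : HasNiceDeriv f φ) {x : ℝ} (hx : 0 ≤ x) : deriv₀ f x = φ x :=
  (h.hasDerivAt x).hasDerivWithinAt.derivWithin (uniqueDiffOn_Ici 0 x hx)

theorem mem_C10 (h : HasNiceDeriv f φ) : f ∈ C10 := by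
  refine ⟨ContDiff.contDiffOn ?_, ?_⟩
  · rw [contDiff_one_iff_deriv]
    refine ⟨fun x => (h.hasDerivAt x).differentiableAt, ?_⟩
    have : deriv (toRealFun f) = φ := funext fun x => (h.hasDerivAt x).deriv
    rw [this]
    exact h.continuous
  · refine h.tendsto_zero.congr' ?_
    filter_upwards [eventually_ge_atTop 0] with x hx using (h.deriv₀_eq hx).symm

theorem tendsto_atBot (h : HasNiceDeriv f φ) : Tendsto φ atBot (𝓝 0) := by
  refine tendsto_const_nhds.congr' ?_
  filter_upwards [eventually_le_atBot 0] with x hx using (h.eq_zero_of_nonpos x hx).symm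

theorem uniformContinuous (h : HasNiceDeriv f φ) : UniformContinuous φ := by
  refine h.continuous.uniformContinuous_of_tendsto_cocompact (x := 0) ?_
  rw [cocompact_eq_atBot_atTop]
  exact h.tendsto_atBot.sup h.tendsto_zero

theorem exists_abs_le (h : HasNiceDeriv f φ) : ∃ C, 0 ≤ C ∧ ∀ x, |φ x| ≤ C := by
  have hc : Tendsto φ (cocompact ℝ) (𝓝 0) := by
    rw [cocompact_eq_atBot_atTop]
    exact h.tendsto_atBot.sup h.tendsto_zero
  let g : C₀(ℝ, ℝ) := ⟨⟨φ, h.continuous⟩, hc⟩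
  exact ⟨‖g.toBCF‖, norm_nonneg _, fun x => g.toBCF.norm_coe_le_norm x⟩

end HasNiceDeriv

theorem exists_hasNiceDeriv {f : C₀(ℝ≥0, ℝ)} (hf : f ∈ C10) (h0 : deriv₀ f 0 = 0) :
    ∃ φ, HasNiceDeriv f φ := by
  have hdiff : ∀ x, 0 ≤ x → HasDerivWithinAt (toRealFun f) (deriv₀ f x) (Ici 0) x := fun x hx =>
    ((hf.1.differentiableOn one_ne_zero) x hx).hasDerivWithinAt
  have hcont : ContinuousOn (deriv₀ f) (Ici 0) :=
    hf.1.continuousOn_derivWithin (uniqueDiffOn_Ici 0) le_rfl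
  refine ⟨fun x => deriv₀ f (max x 0), ?_, fun x hx => ?_, ?_, fun x => ?_⟩
  · exact hcont.comp_continuous (by fun_prop) fun x => le_max_right x 0
  · rw [max_eq_right hx, h0]
  · refine hf.2.congr' ?_
    filter_upwards [eventually_ge_atTop 0] with x hx
    rw [max_eq_left hx]
  · have hconst : ∀ y ≤ (0 : ℝ), HasDerivWithinAt (toRealFun f) 0 (Iic 0) y := fun y hy => by
      refine (hasDerivWithinAt_const y (Iic 0) (f 0)).congr (fun z hz => ?_) ?_
      · exact toRealFun_of_nonpos f hz
      · exact toRealFun_of_nonpos f hy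
    rcases lt_trichotomy x 0 with hx | rfl | hx
    · rw [max_eq_right hx.le, h0]
      exact (hconst x hx.le).hasDerivAt (Iic_mem_nhds hx)
    · rw [max_self]
      have h1 := hdiff 0 le_rfl
      have h2 := hconst 0 le_rfl
      rw [h0] at h1 ⊢
      have := h2.union h1
      rwa [Iic_union_Ici, hasDerivWithinAt_univ] at this
    · rw [max_eq_left hx.le]
      exact (hdiff x hx.le).hasDerivAt (Ici_mem_nhds hx)

end ESN

namespace ESN

/-! ### Small time asymptotics of the tail of the noise -/

section Tail

variable {μ : Measure ℝ}

theorem measure_Ioi_lt_top (hμ_tail : ∀ x : ℝ, 0 < x → μ (Ici x) < ∞) {v : ℝ} (hv : 0 < v) :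
    μ (Ioi v) < ∞ :=
  (measure_mono Ioi_subset_Ici_self).trans_lt (hμ_tail v hv)

theorem measureReal_Ioi_anti (hμ_tail : ∀ x : ℝ, 0 < x → μ (Ici x) < ∞) {u v : ℝ} (hu : 0 < u)
    (huv : u ≤ v) : μ.real (Ioi v) ≤ μ.real (Ioi u) :=
  measureReal_mono (Ioi_subset_Ioi huv) (measure_Ioi_lt_top hμ_tail hu).ne

theorem measurable_measureReal_Ioi (μ : Measure ℝ) : Measurable fun v => μ.real (Ioi v) :=
  (measurable_measure_Ioi μ).ennreal_toReal

variable {b : ℝ} {ρ : ℝ≥0 → Measure ℝ}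

namespace IsNoiseFamily

theorem measureReal_Ioi_le (hρ : IsNoiseFamily μ b ρ)
    (hμ_tail : ∀ x : ℝ, 0 < x → μ (Ici x) < ∞) {c : ℝ} (hc : 0 ≤ c) (hbc : -b ≤ c) {t : ℝ≥0}
    {v : ℝ} (hv : c * t < v) : (ρ t).real (Ioi v) ≤ t * μ.real (Ioi (v - c * t)) := by
  have e : (t : ℝ) * μ.real (Ioi (v - c * t)) = ((t : ℝ≥0∞) * μ (Ioi (v - c * t))).toReal := by
    rw [ENNReal.toReal_mul]; rfl
  rw [e]
  have hv0 : 0 ≤ v := (mul_nonneg hc t.2).trans hv.le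
  exact ENNReal.toReal_mono (ENNReal.mul_ne_top ENNReal.coe_ne_top
    (measure_Ioi_lt_top hμ_tail (by linarith)).ne)
    ((hρ.measure_Ioi_le t hv0).trans (meanExceed_le μ hc hbc t v))

theorem le_measureReal_Ioi (hρ : IsNoiseFamily μ b ρ) {c : ℝ} (hc : 0 ≤ c) (hbc : b ≤ c)
    (t : ℝ≥0) {v : ℝ} (hv : 0 ≤ v) :
    t * μ.real (Ioi (v + c * t)) - (t * μ.real (Ioi (v + c * t))) ^ 2 ≤ (ρ t).real (Ioi v) := by
  have := hρ.isProbabilityMeasure t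
  set L := (t : ℝ) * μ.real (Ioi (v + c * t)) with hL
  have hL0 : 0 ≤ L := by positivity
  have hexp : Real.exp (-L) ≤ 1 - L + L ^ 2 := by
    rw [Real.exp_neg]
    have h1 := Real.add_one_le_exp L
    have h2 : (Real.exp L)⁻¹ ≤ (L + 1)⁻¹ := by gcongr
    refine h2.trans ?_
    rw [inv_le_iff_one_le_mul₀ (by linarith)]
    nlinarith [pow_nonneg hL0 3]
  have hIic : (ρ t).real (Iic v) ≤ Real.exp (-L) := by
    rw [Measure.real, hρ.measure_Iic t v hv, poissonLaw_singleton_zero]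
    split_ifs with h
    · simpa using (Real.exp_pos _).le
    · rw [ENNReal.toReal_ofReal (Real.exp_pos _).le, Real.exp_le_exp, neg_le_neg_iff, hL]
      have e : (t : ℝ) * μ.real (Ioi (v + c * t)) = ((t : ℝ≥0∞) * μ (Ioi (v + c * t))).toReal := by
        rw [ENNReal.toReal_mul]; rfl
      rw [e]
      exact ENNReal.toReal_mono h (le_meanExceed μ hc hbc t v)
  rw [← compl_Iic, probReal_compl_eq_one_sub measurableSet_Iic]
  linarith

end IsNoiseFamily

end Tail

section TailIntegral

variable {μ : Measure ℝ} {b : ℝ} {ρ : ℝ≥0 → Measure ℝ} {φ : ℝ → ℝ}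

theorem lintegral_enorm_mul_lt_top (hμ_tail : ∀ x : ℝ, 0 < x → μ (Ici x) < ∞)
    {C : ℝ} (hC : ∀ x, |φ x| ≤ C) (hfin : ∫⁻ v in Ioc (0 : ℝ) 1, ‖φ v‖ₑ * μ (Ioi v) < ∞)
    {w : ℝ} (hw : 0 ≤ w) (K : ℝ) : ∫⁻ v in Ioc w K, ‖φ v‖ₑ * μ (Ioi v) < ∞ := by
  have hsub : Ioc w K ⊆ Ioc 0 1 ∪ Ioc 1 K := fun v hv => by
    rcases le_or_gt v 1 with h | h
    · exact Or.inl ⟨hw.trans_lt hv.1, h⟩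
    · exact Or.inr ⟨h, hv.2⟩
  refine (lintegral_mono_set hsub).trans_lt ((lintegral_union_le _ _ _).trans_lt ?_)
  refine ENNReal.add_lt_top.2 ⟨hfin, ?_⟩
  have : ∫⁻ v in Ioc 1 K, ‖φ v‖ₑ * μ (Ioi v) ≤
      ∫⁻ v in Ioc 1 K, ENNReal.ofReal C * μ (Ioi 1) := by
    refine setLIntegral_mono' measurableSet_Ioc fun v hv => ?_
    gcongr
    · rw [← ofReal_norm]
      exact ENNReal.ofReal_le_ofReal (hC v)
    · exact hv.1.le
  refine this.trans_lt ?_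
  rw [setLIntegral_const, Real.volume_Ioc]
  exact ENNReal.mul_lt_top (ENNReal.mul_lt_top ENNReal.ofReal_lt_top
    (measure_Ioi_lt_top hμ_tail one_pos)) ENNReal.ofReal_lt_top

theorem integrableOn_mul_measureReal_Ioi (hφ : Continuous φ) {s : Set ℝ}
    (hfin : ∫⁻ v in s, ‖φ v‖ₑ * μ (Ioi v) < ∞) :
    IntegrableOn (fun v => φ v * μ.real (Ioi v)) s := by
  refine ⟨(hφ.measurable.mul (measurable_measureReal_Ioi μ)).aestronglyMeasurable, ?_⟩
  rw [hasFiniteIntegral_iff_enorm]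
  refine lt_of_le_of_lt (lintegral_mono fun v => ?_) hfin
  rw [enorm_mul]
  gcongr
  rw [Real.enorm_of_nonneg measureReal_nonneg]
  exact ENNReal.ofReal_toReal_le

/-- Comparison of the rescaled tail of the noise with the tail of `μ`. -/
theorem IsNoiseFamily.integral_abs_mul_abs_sub_le (hρ : IsNoiseFamily μ b ρ)
    (hμ_tail : ∀ x : ℝ, 0 < x → μ (Ici x) < ∞) (hφ : Continuous φ)
    {C : ℝ} (hC : ∀ x, |φ x| ≤ C) (hfin : ∫⁻ v in Ioc (0 : ℝ) 1, ‖φ v‖ₑ * μ (Ioi v) < ∞)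
    {δ K η : ℝ} (hδ : 0 < δ) (hδK : δ ≤ K) (hη : ∀ x ∈ Ioc 0 δ, |φ x| ≤ η) {t : ℝ≥0} (ht : 0 < t)
    (hbt : |b| * t ≤ δ / 2) :
    ∫ v in Ioc (max (-b) 0 * t) K, |φ v| * |(ρ t).real (Ioi v) / t - μ.real (Ioi v)| ≤
      2 * (∫ v in Ioc 0 δ, |φ v| * μ.real (Ioi v)) + |b| * η +
        C * t * (2 * |b| * μ.real (Ioi (δ / 2)) + K * μ.real (Ioi (δ / 2)) ^ 2) := by
  set T : ℝ := (t : ℝ) with hT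
  have hT0 : 0 < T := by exact_mod_cast ht
  set c : ℝ := max (-b) 0 with hc
  have hc0 : 0 ≤ c := le_max_right _ _
  have hcb : c ≤ |b| := max_le (neg_le_abs b) (abs_nonneg b)
  set m : ℝ → ℝ := fun v => μ.real (Ioi v) with hm
  set q : ℝ → ℝ := fun v => (ρ t).real (Ioi v) / T with hq
  set M : ℝ := m (δ / 2) with hM
  have := hρ.isProbabilityMeasure t
  have hm0 : ∀ v, 0 ≤ m v := fun v => measureReal_nonneg
  have hM0 : 0 ≤ M := hm0 _
  have hq0 : ∀ v, 0 ≤ q v := fun v => div_nonneg measureReal_nonneg hT0.le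
  have hq1 : ∀ v, q v ≤ 1 / T := fun v => div_le_div_of_nonneg_right measureReal_le_one hT0.le
  have hmm : Measurable m := measurable_measureReal_Ioi μ
  have hqm : Measurable q := (measurable_measureReal_Ioi (ρ t)).div_const T
  have hanti : ∀ {u v : ℝ}, 0 < u → u ≤ v → m v ≤ m u := fun hu huv =>
    measureReal_Ioi_anti hμ_tail hu huv
  have hqle : ∀ {d v : ℝ}, 0 ≤ d → -b ≤ d → d * T < v → q v ≤ m (v - d * T) := by
    intro d v hd hbd hv
    rw [hq, div_le_iff₀ hT0, mul_comm]
    exact hρ.measureReal_Ioi_le hμ_tail hd hbd hv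
  have hqge : ∀ {v : ℝ}, 0 ≤ v → m (v + |b| * T) - T * m (v + |b| * T) ^ 2 ≤ q v := by
    intro v hv
    rw [hq, le_div_iff₀ hT0]
    have := hρ.le_measureReal_Ioi (abs_nonneg b) (le_abs_self b) t hv
    refine le_trans (le_of_eq ?_) this
    simp only [hm, hT]
    ring
  have hcT : c * T ≤ δ := by nlinarith
  have hcT0 : 0 ≤ c * T := by positivity
  have hη0 : 0 ≤ η := (abs_nonneg _).trans (hη δ ⟨hδ, le_rfl⟩)
  have hC0 : 0 ≤ C := (abs_nonneg _).trans (hC 0)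
  have hφm : Measurable φ := hφ.measurable
  have hA : ∀ L, IntegrableOn (fun v => |φ v| * m v) (Ioc 0 L) := by
    intro L
    have := (integrableOn_mul_measureReal_Ioi hφ
      (lintegral_enorm_mul_lt_top hμ_tail hC hfin le_rfl L)).norm
    refine this.congr (Eventually.of_forall fun v => ?_)
    change |φ v * m v| = |φ v| * m v
    rw [abs_mul, abs_of_nonneg (hm0 v)]
  have hB : ∀ α β, IntegrableOn (fun v => |φ v| * q v) (Ioc α β) := by
    intro α β
    refine Measure.integrableOn_of_bounded (M := C * (1 / T)) (by simp)
      (by fun_prop) (Eventually.of_forall fun v => ?_)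
    rw [Real.norm_of_nonneg (mul_nonneg (abs_nonneg _) (hq0 v))]
    exact mul_le_mul (hC v) (hq1 v) (hq0 v) hC0
  have hI : IntegrableOn (fun v => |φ v| * |q v - m v|) (Ioc (c * T) K) := by
    refine ((hB (c * T) K).add ((hA K).mono_set (Ioc_subset_Ioc_left hcT0))).mono'
      (by fun_prop) (Eventually.of_forall fun v => ?_)
    rw [Real.norm_of_nonneg (by positivity), Pi.add_apply, ← mul_add]
    have := abs_sub (q v) (m v)
    rw [abs_of_nonneg (hq0 v), abs_of_nonneg (hm0 v)] at this
    gcongr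
  have hsplit : Ioc (c * T) K = Ioc (c * T) δ ∪ Ioc δ K := (Ioc_union_Ioc_eq_Ioc hcT hδK).symm
  rw [hsplit, setIntegral_union (Ioc_disjoint_Ioc_of_le le_rfl) measurableSet_Ioc
    (hI.mono_set (Ioc_subset_Ioc_right hδK)) (hI.mono_set (Ioc_subset_Ioc_left hcT))]
  have part1 : ∫ v in Ioc (c * T) δ, |φ v| * |q v - m v| ≤
      2 * (∫ v in Ioc 0 δ, |φ v| * m v) + |b| * η := by
    set n : ℝ → ℝ := fun v => min (1 / T) (m v) with hn
    have hnm : Measurable n := measurable_const.min hmm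
    have hn0 : ∀ v, 0 ≤ n v := fun v => le_min (by positivity) (hm0 v)
    have hnT : ∀ v, n v ≤ 1 / T := fun v => min_le_left _ _
    have hshift := integral_shift_sub_shift_le hnm hn0 hnT hcT0 le_rfl (c * T) δ
    have hi1 : IntegrableOn (fun v => n (v - c * T) - n (v + 0)) (Ioc (c * T) δ) := by
      rw [← intervalIntegrable_iff_integrableOn_Ioc_of_le hcT]
      exact (intervalIntegrable_of_bounded (hnm.comp (measurable_id.sub_const (c * T)))
        (fun v => hn0 _) (fun v => hnT _) _ _).sub
        (intervalIntegrable_of_bounded (hnm.comp (measurable_id.add_const 0))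
        (fun v => hn0 _) (fun v => hnT _) _ _)
    have hi2 : IntegrableOn (fun v => |φ v| * m v) (Ioc (c * T) δ) :=
      (hA δ).mono_set (Ioc_subset_Ioc_left hcT0)
    calc ∫ v in Ioc (c * T) δ, |φ v| * |q v - m v|
        ≤ ∫ v in Ioc (c * T) δ,
            (2 * (|φ v| * m v) + η * (n (v - c * T) - n (v + 0))) := by
          refine setIntegral_mono_on (hI.mono_set (Ioc_subset_Ioc_right hδK))
            ((hi2.const_mul 2).add (hi1.const_mul η)) measurableSet_Ioc fun v hv => ?_
          have hv0 : 0 < v - c * T := by linarith [hv.1]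
          have h1 : q v ≤ n (v - c * T) := le_min (hq1 v) (hqle hc0 (le_max_left _ _) hv.1)
          have h2 : n v ≤ n (v - c * T) := min_le_min_left _ (hanti hv0 (by linarith))
          have h3 := abs_sub (q v) (m v)
          rw [abs_of_nonneg (hq0 v), abs_of_nonneg (hm0 v)] at h3
          have h4 : |φ v| ≤ η := hη v ⟨by linarith, hv.2⟩
          have h5 : n v ≤ m v := min_le_right _ _
          rw [add_zero]
          have h6 : |φ v| * |q v - m v| ≤ |φ v| * (n (v - c * T) + m v) := by
            gcongr
            linarith
          have h7 : |φ v| * (n (v - c * T) - n v) ≤ η * (n (v - c * T) - n v) :=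
            mul_le_mul_of_nonneg_right h4 (by linarith)
          have h8 : |φ v| * n v ≤ |φ v| * m v := by gcongr
          linarith
      _ = 2 * (∫ v in Ioc (c * T) δ, |φ v| * m v) +
            η * ∫ v in Ioc (c * T) δ, (n (v - c * T) - n (v + 0)) := by
          rw [integral_add (hi2.const_mul 2) (hi1.const_mul η), integral_const_mul,
            integral_const_mul]
      _ ≤ 2 * (∫ v in Ioc 0 δ, |φ v| * m v) + η * c := by
          have e1 : ∫ v in Ioc (c * T) δ, |φ v| * m v ≤ ∫ v in Ioc 0 δ, |φ v| * m v :=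
            setIntegral_mono_set (hA δ)
              (Eventually.of_forall fun v => mul_nonneg (abs_nonneg _) (hm0 v))
              (Ioc_subset_Ioc_left hcT0).eventuallyLE
          rw [intervalIntegral.integral_of_le hcT] at hshift
          have e2 : (c * T + 0) * (1 / T) = c := by field_simp; ring
          rw [e2] at hshift
          gcongr
      _ ≤ _ := by nlinarith
  have part2 : ∫ v in Ioc δ K, |φ v| * |q v - m v| ≤ C * T * (2 * |b| * M + K * M ^ 2) := by
    set s : ℝ := |b| * T with hs
    have hs0 : 0 ≤ s := by positivity
    set n : ℝ → ℝ := fun v => min M (m v) with hn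
    have hnm : Measurable n := measurable_const.min hmm
    have hn0 : ∀ v, 0 ≤ n v := fun v => le_min hM0 (hm0 v)
    have hnM : ∀ v, n v ≤ M := fun v => min_le_left _ _
    have hneq : ∀ v, δ / 2 ≤ v → n v = m v := fun v hv => min_eq_right (hanti (half_pos hδ) hv)
    have hshift := integral_shift_sub_shift_le hnm hn0 hnM hs0 hs0 δ K
    have hi1 : IntegrableOn (fun v => n (v - s) - n (v + s)) (Ioc δ K) := by
      rw [← intervalIntegrable_iff_integrableOn_Ioc_of_le hδK]
      exact (intervalIntegrable_of_bounded (hnm.comp (measurable_id.sub_const s))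
        (fun v => hn0 _) (fun v => hnM _) _ _).sub
        (intervalIntegrable_of_bounded (hnm.comp (measurable_id.add_const s))
        (fun v => hn0 _) (fun v => hnM _) _ _)
    have hi2 : IntegrableOn (fun _ : ℝ => T * M ^ 2) (Ioc δ K) :=
      integrableOn_const (by simp) enorm_ne_top
    calc ∫ v in Ioc δ K, |φ v| * |q v - m v|
        ≤ ∫ v in Ioc δ K, C * ((n (v - s) - n (v + s)) + T * M ^ 2) := by
          refine setIntegral_mono_on (hI.mono_set (Ioc_subset_Ioc_left hcT))
            ((hi1.add hi2).const_mul C) measurableSet_Ioc fun v hv => ?_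
          have hv1 : δ / 2 ≤ v - s := by linarith [hv.1]
          have hvp : 0 < v := hδ.trans hv.1
          have h1 : q v ≤ m (v - s) := hqle (abs_nonneg b) (neg_le_abs b) (by linarith)
          have h2 : m v ≤ m (v - s) := hanti (by linarith) (by linarith)
          have h3 : m (v + s) ≤ m v := hanti hvp (by linarith)
          have h4 := hqge hvp.le
          have h5 : m (v + s) ≤ M := hanti (half_pos hδ) (by linarith)
          have h6 : T * m (v + s) ^ 2 ≤ T * M ^ 2 := by
            have := hm0 (v + s)
            gcongr
          rw [hneq _ hv1, hneq _ (by linarith)]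
          refine mul_le_mul (hC v) ?_ (abs_nonneg _) hC0
          have h7 : 0 ≤ T * M ^ 2 := by positivity
          rw [abs_le]
          constructor <;> linarith
      _ = C * ((∫ v in Ioc δ K, (n (v - s) - n (v + s))) + (K - δ) * (T * M ^ 2)) := by
          rw [integral_const_mul, integral_add hi1 hi2, setIntegral_const, smul_eq_mul,
            Real.volume_real_Ioc_of_le hδK]
      _ ≤ C * ((s + s) * M + K * (T * M ^ 2)) := by
          rw [intervalIntegral.integral_of_le hδK] at hshift
          have : (K - δ) * (T * M ^ 2) ≤ K * (T * M ^ 2) := by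
            have : 0 ≤ T * M ^ 2 := by positivity
            nlinarith
          gcongr
      _ = _ := by rw [hs]; ring
  linarith

end TailIntegral

end ESN

namespace ESN

/-! ### The generator on smooth functions -/

/-- The jump part `x ↦ ∫_{(x,∞)} (F y - F x) μ(dy)` of the generator. -/
noncomputable def jumpPart (μ : Measure ℝ) (F : ℝ → ℝ) (x : ℝ) : ℝ :=
  ∫ y in Ioi x, (F y - F x) ∂μ

section Estimates

variable {μ : Measure ℝ} {b : ℝ} {ρ : ℝ≥0 → Measure ℝ} {f : C₀(ℝ≥0, ℝ)} {φ : ℝ → ℝ}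

theorem HasNiceDeriv.jumpPart_eq [SFinite μ] (hf : HasNiceDeriv f φ)
    (hμ_tail : ∀ x : ℝ, 0 < x → μ (Ici x) < ∞)
    (hfin : ∫⁻ v in Ioc (0 : ℝ) 1, ‖φ v‖ₑ * μ (Ioi v) < ∞) {w K : ℝ} (hw : 0 ≤ w) (hwK : w ≤ K)
    (hK : 0 < K) :
    IntegrableOn (fun y => toRealFun f y - toRealFun f w) (Ioi w) μ ∧
      jumpPart μ (toRealFun f) w =
        (∫ v in Ioc w K, φ v * μ.real (Ioi v)) + jumpPart μ (toRealFun f) K := by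
  obtain ⟨C, -, hC⟩ := hf.exists_abs_le
  exact integrableOn_sub_and_integral_eq hf.hasDerivAt hf.continuous (abs_toRealFun_le f) μ hwK
    (lintegral_enorm_mul_lt_top hμ_tail hC hfin hw K) (measure_Ioi_lt_top hμ_tail hK)

theorem integrableOn_abs_mul (hμ_tail : ∀ x : ℝ, 0 < x → μ (Ici x) < ∞) (hφ : Continuous φ)
    {C : ℝ} (hC : ∀ x, |φ x| ≤ C) (hfin : ∫⁻ v in Ioc (0 : ℝ) 1, ‖φ v‖ₑ * μ (Ioi v) < ∞) (K : ℝ) :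
    IntegrableOn (fun v => |φ v| * μ.real (Ioi v)) (Ioc 0 K) := by
  have := (integrableOn_mul_measureReal_Ioi hφ
    (lintegral_enorm_mul_lt_top hμ_tail hC hfin le_rfl K)).norm
  refine this.congr (Eventually.of_forall fun v => ?_)
  change |φ v * μ.real (Ioi v)| = |φ v| * μ.real (Ioi v)
  rw [abs_mul, abs_of_nonneg measureReal_nonneg]

theorem HasNiceDeriv.abs_jumpPart_sub_le [SFinite μ] (hf : HasNiceDeriv f φ)
    (hμ_tail : ∀ x : ℝ, 0 < x → μ (Ici x) < ∞)
    (hfin : ∫⁻ v in Ioc (0 : ℝ) 1, ‖φ v‖ₑ * μ (Ioi v) < ∞) {C : ℝ} (hC : ∀ x, |φ x| ≤ C)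
    {δ : ℝ} (hδ : 0 < δ) {x x' : ℝ} (hx : 0 ≤ x) (hxx' : x ≤ x') :
    |jumpPart μ (toRealFun f) x - jumpPart μ (toRealFun f) x'| ≤
      (∫ v in Ioc 0 δ, |φ v| * μ.real (Ioi v)) + C * μ.real (Ioi δ) * (x' - x) := by
  have hnn : ∀ v, 0 ≤ |φ v| * μ.real (Ioi v) := fun v => mul_nonneg (abs_nonneg _) measureReal_nonneg
  have hC0 : 0 ≤ C := (abs_nonneg _).trans (hC 0)
  have hI0 : 0 ≤ ∫ v in Ioc 0 δ, |φ v| * μ.real (Ioi v) := integral_nonneg hnn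
  rcases (hx.trans hxx').eq_or_lt with h0 | h0
  · have : x = x' := le_antisymm hxx' (by linarith)
    rw [this, sub_self, abs_zero, sub_self, mul_zero, add_zero]
    exact hI0
  rw [(hf.jumpPart_eq hμ_tail hfin hx hxx' h0).2, add_sub_cancel_right]
  have hA := integrableOn_abs_mul hμ_tail hf.continuous hC hfin
  have h1 : IntegrableOn ((Ioc 0 δ).indicator fun v => |φ v| * μ.real (Ioi v)) (Ioc x x') :=
    ((integrable_indicator_iff measurableSet_Ioc).2 (hA δ)).integrableOn
  have h2 : IntegrableOn (fun _ : ℝ => C * μ.real (Ioi δ)) (Ioc x x') :=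
    integrableOn_const (by simp) enorm_ne_top
  have h3 : ∀ᵐ v ∂volume.restrict (Ioc x x'), ‖φ v * μ.real (Ioi v)‖ ≤
      (Ioc 0 δ).indicator (fun v => |φ v| * μ.real (Ioi v)) v + C * μ.real (Ioi δ) := by
    filter_upwards [ae_restrict_mem measurableSet_Ioc] with v hv
    rw [norm_mul, Real.norm_eq_abs, Real.norm_of_nonneg measureReal_nonneg]
    by_cases hvδ : v ≤ δ
    · have hmem : v ∈ Ioc 0 δ := ⟨hx.trans_lt hv.1, hvδ⟩
      rw [indicator_of_mem hmem]
      have : 0 ≤ C * μ.real (Ioi δ) := mul_nonneg hC0 measureReal_nonneg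
      linarith
    · rw [indicator_of_notMem fun h => hvδ h.2, zero_add]
      exact mul_le_mul (hC v) (measureReal_Ioi_anti hμ_tail hδ (not_le.1 hvδ).le)
        measureReal_nonneg hC0
  refine (norm_integral_le_of_norm_le (h1.add h2) h3).trans ?_
  simp only [Pi.add_apply]
  rw [integral_add h1 h2, integral_indicator measurableSet_Ioc, setIntegral_const, smul_eq_mul,
    Measure.restrict_restrict measurableSet_Ioc, Real.volume_real_Ioc_of_le hxx', mul_comm (x' - x)]
  gcongr ?_ + _
  exact setIntegral_mono_set (hA δ) (Eventually.of_forall hnn) inter_subset_left.eventuallyLE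

theorem HasNiceDeriv.abs_sub_add_mul_le (hf : HasNiceDeriv f φ) {x h ω : ℝ}
    (hω : ∀ y, |y - x| ≤ |h| → |φ y - φ x| ≤ ω) :
    |toRealFun f (x - h) - toRealFun f x + h * φ x| ≤ ω * |h| := by
  have hd : ∀ y ∈ Metric.closedBall x |h|, HasDerivWithinAt (fun y => toRealFun f y - y * φ x)
      (φ y - φ x) (Metric.closedBall x |h|) y := fun y _ => by
    have := ((hf.hasDerivAt y).sub ((hasDerivAt_id y).mul_const (φ x))).hasDerivWithinAt
      (s := Metric.closedBall x |h|)
    rwa [one_mul] at this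
  have := (convex_closedBall x |h|).norm_image_sub_le_of_norm_hasDerivWithin_le hd
    (C := ω) (fun y hy => hω y (by simpa [Real.dist_eq] using hy))
    (Metric.mem_closedBall_self (abs_nonneg h)) (y := x - h) (by simp)
  rw [Real.norm_eq_abs, Real.norm_eq_abs] at this
  have e1 : toRealFun f (x - h) - (x - h) * φ x - (toRealFun f x - x * φ x) =
      toRealFun f (x - h) - toRealFun f x + h * φ x := by ring
  have e2 : x - h - x = -h := by ring
  rwa [e1, e2, abs_neg] at this

theorem transition_sub_eq [∀ t, IsProbabilityMeasure (ρ t)] (f : C₀(ℝ≥0, ℝ)) (t x : ℝ≥0) :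
    transition b t (ρ t) f x - toRealFun f (x - b * t) =
      jumpPart (ρ t) (toRealFun f) (max (x - b * t) 0) := by
  have hc : toRealFun f (x - b * t) = ∫ _z, toRealFun f (x - b * t) ∂ρ t := by simp
  rw [transition_apply, hc, ← integral_sub (integrable_toRealFun_comp f _ (by fun_prop))
    (integrable_const _), jumpPart]
  have hF : ∀ y, toRealFun f (max y 0) = toRealFun f y := fun y => by
    rcases le_total y 0 with h | h
    · rw [max_eq_right h, toRealFun_of_nonpos f h, toRealFun_of_nonpos f le_rfl]
    · rw [max_eq_left h]
  rw [← setIntegral_eq_integral_of_forall_compl_eq_zero (s := Ioi (max ((x : ℝ) - b * t) 0))]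
  · refine setIntegral_congr_fun measurableSet_Ioi fun z hz => ?_
    have : max ((x : ℝ) - b * t) 0 < z := hz
    rw [max_eq_right ((le_max_left _ _).trans this.le), hF]
  · intro z hz
    have hz' : z ≤ max ((x : ℝ) - b * t) 0 := not_lt.1 hz
    rw [← hF (max _ z), max_assoc, max_comm z 0, ← max_assoc, max_eq_left hz', hF, sub_self]

theorem IsNoiseFamily.abs_jumpPart_div_sub_le [SFinite μ] [∀ t, IsProbabilityMeasure (ρ t)]
    (hρ : IsNoiseFamily μ b ρ) (hf : HasNiceDeriv f φ)
    (hμ_tail : ∀ x : ℝ, 0 < x → μ (Ici x) < ∞)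
    (hfin : ∫⁻ v in Ioc (0 : ℝ) 1, ‖φ v‖ₑ * μ (Ioi v) < ∞) {K ε : ℝ} (hK : 1 ≤ K)
    (hKε : ∀ x, K ≤ x → |toRealFun f x| ≤ ε) {t : ℝ≥0} (ht : 0 < t) (hbt : |b| * t ≤ 1 / 2)
    {w : ℝ} (hw : max (-b) 0 * t ≤ w) :
    |jumpPart (ρ t) (toRealFun f) w / t - jumpPart μ (toRealFun f) w| ≤
      (∫ v in Ioc (max (-b) 0 * t) K, |φ v| * |(ρ t).real (Ioi v) / t - μ.real (Ioi v)|) +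
        4 * ε * μ.real (Ioi (1 / 2)) := by
  obtain ⟨C, hC0, hC⟩ := hf.exists_abs_le
  set T : ℝ := (t : ℝ) with hT
  have hT0 : 0 < T := by exact_mod_cast ht
  set c : ℝ := max (-b) 0 with hc
  have hc0 : 0 ≤ c := le_max_right _ _
  have hw0 : 0 ≤ w := (mul_nonneg hc0 hT0.le).trans hw
  have hε0 : 0 ≤ ε := (abs_nonneg _).trans (hKε K le_rfl)
  have hnn : ∀ v, 0 ≤ |φ v| * |(ρ t).real (Ioi v) / T - μ.real (Ioi v)| := fun v => by positivity
  have htail : ∀ L, K ≤ L → |jumpPart (ρ t) (toRealFun f) L / T - jumpPart μ (toRealFun f) L| ≤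
      4 * ε * μ.real (Ioi (1 / 2)) := by
    intro L hL
    have hL0 : 0 < L := by linarith
    have hL' : ∀ x, L ≤ x → |toRealFun f x| ≤ ε := fun x hx => hKε x (hL.trans hx)
    have h1 := norm_integral_Ioi_sub_le hL' (measure_lt_top (ρ t) (Ioi L))
    have h2 := norm_integral_Ioi_sub_le hL' (measure_Ioi_lt_top hμ_tail hL0)
    have h3 : (ρ t).real (Ioi L) ≤ T * μ.real (Ioi (1 / 2)) := by
      have := hρ.measureReal_Ioi_le hμ_tail (abs_nonneg b) (neg_le_abs b) (t := t) (v := L)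
        (by linarith)
      exact this.trans (mul_le_mul_of_nonneg_left
        (measureReal_Ioi_anti hμ_tail one_half_pos (by linarith)) hT0.le)
    have h4 : μ.real (Ioi L) ≤ μ.real (Ioi (1 / 2)) :=
      measureReal_Ioi_anti hμ_tail one_half_pos (by linarith)
    have h5 : |jumpPart (ρ t) (toRealFun f) L / T| ≤ 2 * ε * μ.real (Ioi (1 / 2)) := by
      rw [abs_div, abs_of_pos hT0, div_le_iff₀ hT0]
      calc _ ≤ 2 * ε * (ρ t).real (Ioi L) := h1
        _ ≤ 2 * ε * (T * μ.real (Ioi (1 / 2))) := by gcongr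
        _ = _ := by ring
    have h6 : |jumpPart μ (toRealFun f) L| ≤ 2 * ε * μ.real (Ioi (1 / 2)) :=
      h2.trans (by gcongr)
    have := abs_sub (jumpPart (ρ t) (toRealFun f) L / T) (jumpPart μ (toRealFun f) L)
    linarith
  rcases le_total K w with hKw | hwK
  · exact (htail w hKw).trans (le_add_of_nonneg_left (integral_nonneg hnn))
  have hfin1 : ∫⁻ v in Ioc w K, ‖φ v‖ₑ * ρ t (Ioi v) < ∞ := by
    have : ∫⁻ v in Ioc w K, ‖φ v‖ₑ * ρ t (Ioi v) ≤ ∫⁻ v in Ioc w K, ENNReal.ofReal C * 1 := by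
      refine lintegral_mono fun v => ?_
      gcongr
      · rw [← ofReal_norm]
        exact ENNReal.ofReal_le_ofReal (hC v)
      · exact prob_le_one
    refine this.trans_lt ?_
    rw [setLIntegral_const, Real.volume_Ioc, mul_one]
    exact ENNReal.mul_lt_top ENNReal.ofReal_lt_top ENNReal.ofReal_lt_top
  have hfin2 := lintegral_enorm_mul_lt_top hμ_tail hC hfin hw0 K
  have hdec1 : jumpPart (ρ t) (toRealFun f) w =
      (∫ v in Ioc w K, φ v * (ρ t).real (Ioi v)) + jumpPart (ρ t) (toRealFun f) K :=
    (integrableOn_sub_and_integral_eq hf.hasDerivAt hf.continuous (abs_toRealFun_le f) (ρ t)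
      hwK hfin1 (measure_lt_top _ _)).2
  have hdec2 := (hf.jumpPart_eq hμ_tail hfin hw0 hwK (by linarith : 0 < K)).2
  have hi1 := (integrableOn_mul_measureReal_Ioi hf.continuous hfin1).div_const T
  have hi2 := integrableOn_mul_measureReal_Ioi hf.continuous hfin2
  have heq : jumpPart (ρ t) (toRealFun f) w / T - jumpPart μ (toRealFun f) w =
      (∫ v in Ioc w K, φ v * ((ρ t).real (Ioi v) / T - μ.real (Ioi v))) +
        (jumpPart (ρ t) (toRealFun f) K / T - jumpPart μ (toRealFun f) K) := by
    have : ∫ v in Ioc w K, φ v * ((ρ t).real (Ioi v) / T - μ.real (Ioi v)) =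
        (∫ v in Ioc w K, φ v * (ρ t).real (Ioi v)) / T - ∫ v in Ioc w K, φ v * μ.real (Ioi v) := by
      rw [← integral_div, ← integral_sub hi1 hi2]
      refine integral_congr_ae (Eventually.of_forall fun v => ?_)
      simp only
      ring
    rw [this, hdec1, hdec2]
    ring
  rw [heq]
  refine (abs_add_le _ _).trans (add_le_add ?_ (htail K le_rfl))
  refine (norm_integral_le_integral_norm fun v =>
    φ v * ((ρ t).real (Ioi v) / T - μ.real (Ioi v))).trans ?_
  simp only [norm_mul, Real.norm_eq_abs]
  have hmono : ∀ v, |φ v| * |(ρ t).real (Ioi v) / T - μ.real (Ioi v)| ≤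
      C * (1 / T) + |φ v| * μ.real (Ioi v) := fun v => by
    have h1 := abs_sub ((ρ t).real (Ioi v) / T) (μ.real (Ioi v))
    have h2 : |(ρ t).real (Ioi v) / T| ≤ 1 / T := by
      rw [abs_of_nonneg (by positivity)]
      exact div_le_div_of_nonneg_right measureReal_le_one hT0.le
    rw [abs_of_nonneg (measureReal_nonneg (μ := μ) (s := Ioi v))] at h1
    calc _ ≤ |φ v| * (1 / T + μ.real (Ioi v)) := by gcongr; linarith
      _ ≤ _ := by
        rw [mul_add]
        gcongr
        exact hC v
  have hi : IntegrableOn (fun v => |φ v| * |(ρ t).real (Ioi v) / T - μ.real (Ioi v)|)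
      (Ioc (c * T) K) := by
    have h1 : IntegrableOn (fun _ : ℝ => C * (1 / T)) (Ioc (c * T) K) :=
      integrableOn_const (by simp) enorm_ne_top
    have h2 := (integrableOn_abs_mul hμ_tail hf.continuous hC hfin K).mono_set
      (Ioc_subset_Ioc_left (mul_nonneg hc0 hT0.le))
    have hφm := hf.continuous.measurable
    have hqm := measurable_measureReal_Ioi (ρ t)
    have hmm := measurable_measureReal_Ioi μ
    refine (h1.add h2).mono' (by fun_prop) (Eventually.of_forall fun v => ?_)
    rw [Real.norm_of_nonneg (hnn v)]
    exact hmono v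
  exact setIntegral_mono_set hi (Eventually.of_forall hnn) (Ioc_subset_Ioc_left hw).eventuallyLE

theorem exists_integral_Ioc_le (hμ_tail : ∀ x : ℝ, 0 < x → μ (Ici x) < ∞) (hφ : Continuous φ)
    {C : ℝ} (hC : ∀ x, |φ x| ≤ C) (hfin : ∫⁻ v in Ioc (0 : ℝ) 1, ‖φ v‖ₑ * μ (Ioi v) < ∞) {ε : ℝ}
    (hε : 0 < ε) : ∀ᶠ δ in 𝓝[>] (0 : ℝ), ∫ v in Ioc 0 δ, |φ v| * μ.real (Ioi v) ≤ ε := by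
  have hI := integrableOn_abs_mul hμ_tail hφ hC hfin 1
  have hI' : IntegrableOn (fun v => |φ v| * μ.real (Ioi v)) (uIcc 0 1) := by
    rw [uIcc_of_le zero_le_one, integrableOn_Icc_iff_integrableOn_Ioc]
    exact hI
  have h : ContinuousWithinAt (fun x => ∫ v in (0 : ℝ)..x, |φ v| * μ.real (Ioi v)) (uIcc 0 1) 0 :=
    intervalIntegral.continuousOn_primitive_interval hI' 0 left_mem_uIcc
  have h0 : Tendsto (fun x => ∫ v in (0 : ℝ)..x, |φ v| * μ.real (Ioi v)) (𝓝[>] 0) (𝓝 0) := by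
    rw [← nhdsWithin_Ioc_eq_nhdsGT (zero_lt_one (α := ℝ))]
    have := h.tendsto.mono_left (nhdsWithin_mono 0
      (show Ioc (0 : ℝ) 1 ⊆ uIcc 0 1 by rw [uIcc_of_le zero_le_one]; exact Ioc_subset_Icc_self))
    rwa [intervalIntegral.integral_same] at this
  filter_upwards [h0.eventually (gt_mem_nhds hε), self_mem_nhdsWithin] with δ h1 h2
  rw [← intervalIntegral.integral_of_le (le_of_lt h2)]
  exact h1.le

end Estimates

section Generator

variable {μ : Measure ℝ} [SFinite μ] {b : ℝ} {ρ : ℝ≥0 → Measure ℝ}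
  [∀ t, IsProbabilityMeasure (ρ t)] {f : C₀(ℝ≥0, ℝ)} {φ : ℝ → ℝ}

theorem IsNoiseFamily.eventually_abs_sub_le (hρ : IsNoiseFamily μ b ρ) (hf : HasNiceDeriv f φ)
    (hμ_tail : ∀ x : ℝ, 0 < x → μ (Ici x) < ∞)
    (hfin : ∫⁻ v in Ioc (0 : ℝ) 1, ‖φ v‖ₑ * μ (Ioi v) < ∞) {ε : ℝ} (hε : 0 < ε) :
    ∀ᶠ t in 𝓝[>] (0 : ℝ≥0), ∀ x : ℝ≥0, |(transition b t (ρ t) f x - f x) / t -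
      (jumpPart μ (toRealFun f) x - b * φ x)| ≤ ε := by
  obtain ⟨C, hC0, hC⟩ := hf.exists_abs_le
  set M := μ.real (Ioi (1 / 2)) with hM
  have hM0 : 0 ≤ M := measureReal_nonneg
  have hb0 := abs_nonneg b
  -- far away, `f` is small
  obtain ⟨K, hK1, hKε⟩ : ∃ K : ℝ, 1 ≤ K ∧ ∀ x, K ≤ x → |toRealFun f x| ≤ ε / (32 * (M + 1)) := by
    have h1 := (tendsto_toRealFun_atTop f).eventually
      (Metric.ball_mem_nhds 0 (show 0 < ε / (32 * (M + 1)) by positivity))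
    obtain ⟨K, hK⟩ := (h1.and (eventually_ge_atTop 1)).exists_forall_of_atTop
    refine ⟨K, (hK K le_rfl).2, fun x hx => ?_⟩
    have := (hK x hx).1
    rw [dist_zero_right] at this
    exact this.le
  -- near the origin, `φ` is small
  set η := ε / (8 * (|b| + 1)) with hη
  have hη0 : 0 < η := by positivity
  obtain ⟨δ, hδ0, hδ1, hδI, hδη⟩ : ∃ δ : ℝ, 0 < δ ∧ δ ≤ 1 ∧
      (∫ v in Ioc 0 δ, |φ v| * μ.real (Ioi v) ≤ ε / 24) ∧ ∀ x ∈ Ioc 0 δ, |φ x| ≤ η := by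
    have h1 := exists_integral_Ioc_le hμ_tail hf.continuous hC hfin
      (show 0 < ε / 24 by positivity)
    have h2 : ∀ᶠ δ in 𝓝[>] (0 : ℝ), ∀ x ∈ Ioc 0 δ, |φ x| ≤ η := by
      have := hf.continuous.continuousAt (x := 0)
      obtain ⟨r, hr, hball⟩ := Metric.continuousAt_iff.1 this η hη0
      filter_upwards [Ioo_mem_nhdsGT hr] with δ hδ x hx
      have := hball (x := x) (by
        rw [Real.dist_eq, sub_zero, abs_of_pos hx.1]; exact hx.2.trans_lt hδ.2)
      rw [hf.eq_zero_of_nonpos 0 le_rfl, Real.dist_eq, sub_zero] at this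
      exact this.le
    obtain ⟨δ, ⟨h1, h2⟩, h3⟩ := ((h1.and h2).and (Ioc_mem_nhdsGT one_pos)).exists
    exact ⟨δ, h3.1, h3.2, h1, h2⟩
  -- the modulus of continuity of `φ`
  obtain ⟨r, hr, hunif⟩ := Metric.uniformContinuous_iff.1 hf.uniformContinuous η hη0
  have hlim : ∀ A : ℝ, Tendsto (fun t : ℝ≥0 => A * (t : ℝ)) (𝓝[>] 0) (𝓝 0) := fun A => by
    have : Tendsto (fun t : ℝ≥0 => A * (t : ℝ)) (𝓝 0) (𝓝 (A * ((0 : ℝ≥0) : ℝ))) :=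
      Continuous.tendsto (by fun_prop) 0
    simpa using this.mono_left nhdsWithin_le_nhds
  set B := 2 * |b| * μ.real (Ioi (δ / 2)) + K * μ.real (Ioi (δ / 2)) ^ 2 with hB
  filter_upwards [(hlim |b|).eventually (gt_mem_nhds hr),
    (hlim |b|).eventually (gt_mem_nhds (half_pos hδ0)),
    (hlim (C * B)).eventually (gt_mem_nhds (show 0 < ε / 8 by positivity)),
    (hlim (C * μ.real (Ioi δ) * |b|)).eventually (gt_mem_nhds (show 0 < ε / 8 by positivity)),
    self_mem_nhdsWithin] with t ht1 ht2 ht3 ht4 ht x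
  have htpos : 0 < t := ht
  have hT0 : (0 : ℝ) < t := by exact_mod_cast htpos
  have hx0 : (0 : ℝ) ≤ x := x.2
  set w : ℝ := max (x - b * t) 0 with hw
  have habs : |b * t| = |b| * t := by rw [abs_mul, NNReal.abs_eq]
  have hcw : max (-b) 0 * t ≤ w := by
    rcases le_total (-b) 0 with hb | hb
    · rw [max_eq_right hb, zero_mul]; exact le_max_right _ _
    · rw [max_eq_left hb]; exact le_max_of_le_left (by linarith)
  have hwx : |w - x| ≤ |b| * t := by
    have h1 : |w - x| ≤ |(x - b * t) - x| := by
      have := abs_max_sub_max_le_abs ((x : ℝ) - b * t) x 0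
      rwa [max_eq_left hx0] at this
    rwa [sub_sub_cancel_left, abs_neg, habs] at h1
  have E1 : |(toRealFun f (x - b * t) - toRealFun f x) / t + b * φ x| ≤ ε / 8 := by
    have := hf.abs_sub_add_mul_le (x := x) (h := b * t) (ω := η) fun y hy => by
      have := hunif (a := y) (b := x) (by rw [Real.dist_eq]; linarith)
      exact this.le
    have e : (toRealFun f (x - b * t) - toRealFun f x) / t + b * φ x =
        (toRealFun f (x - b * t) - toRealFun f x + b * t * φ x) / t := by field_simp
    rw [e, abs_div, abs_of_pos hT0, div_le_iff₀ hT0]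
    refine this.trans ?_
    rw [habs, ← mul_assoc]
    gcongr
    rw [hη, div_mul_eq_mul_div, div_le_div_iff₀ (by positivity) (by norm_num)]
    nlinarith
  have E2 := hρ.abs_jumpPart_div_sub_le hf hμ_tail hfin hK1 hKε htpos (by linarith) hcw
  have E2' := hρ.integral_abs_mul_abs_sub_le hμ_tail hf.continuous hC hfin hδ0 (hδ1.trans hK1)
    hδη htpos ht2.le
  have E3 : |jumpPart μ (toRealFun f) w - jumpPart μ (toRealFun f) x| ≤ ε / 24 + ε / 8 := by
    have hstep : ∀ y y' : ℝ, 0 ≤ y → y ≤ y' → |y' - y| ≤ |b| * t →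
        |jumpPart μ (toRealFun f) y - jumpPart μ (toRealFun f) y'| ≤ ε / 24 + ε / 8 := by
      intro y y' hy hyy' hyb
      have h1 := hf.abs_jumpPart_sub_le hμ_tail hfin hC hδ0 hy hyy'
      have h2 : C * μ.real (Ioi δ) * (y' - y) ≤ C * μ.real (Ioi δ) * (|b| * t) := by
        have := measureReal_nonneg (μ := μ) (s := Ioi δ)
        gcongr
        exact (le_abs_self _).trans hyb
      linarith
    rcases le_total w x with h | h
    · exact hstep w x (le_max_right _ _) h (by rwa [abs_sub_comm])
    · rw [abs_sub_comm]; exact hstep x w hx0 h hwx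
  have e1 : 4 * (ε / (32 * (M + 1))) * M ≤ ε / 8 := by
    have : 4 * (ε / (32 * (M + 1))) * M = ε / 8 * (M / (M + 1)) := by field_simp; ring
    rw [this]
    exact mul_le_of_le_one_right (by positivity) ((div_le_one (by positivity)).2 (by linarith))
  have e2 : |b| * η ≤ ε / 8 := by
    rw [hη, mul_div_assoc', div_le_div_iff₀ (by positivity) (by norm_num)]
    nlinarith
  have e3 : C * t * B = C * B * t := by ring
  rw [← hB, e3] at E2'
  have hdec : (transition b t (ρ t) f x - f x) / t - (jumpPart μ (toRealFun f) x - b * φ x) =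
      ((toRealFun f (x - b * t) - toRealFun f x) / t + b * φ x) +
      (jumpPart (ρ t) (toRealFun f) w / t - jumpPart μ (toRealFun f) w) +
      (jumpPart μ (toRealFun f) w - jumpPart μ (toRealFun f) x) := by
    rw [hw, ← transition_sub_eq f t x, ← hw, ← toRealFun_coe f x]
    ring
  rw [hdec]
  refine (abs_add_three _ _ _).trans ?_
  linarith

/-- Smooth functions are in the domain of the generator, which acts on them as an
integro-differential operator. -/
theorem IsNoiseFamily.exists_mem_infinitesimalGraph (hρ : IsNoiseFamily μ b ρ)
    (hf : HasNiceDeriv f φ) (hμ_tail : ∀ x : ℝ, 0 < x → μ (Ici x) < ∞)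
    (hfin : ∫⁻ v in Ioc (0 : ℝ) 1, ‖φ v‖ₑ * μ (Ioi v) < ∞) :
    ∃ g, (f, g) ∈ infinitesimalGraph (fun t => transition b t (ρ t)) ∧
      ∀ x : ℝ≥0, g x = jumpPart μ (toRealFun f) x - b * φ x := by
  set L : ℝ≥0 → ℝ := fun x => jumpPart μ (toRealFun f) x - b * φ x with hL
  have hunif : TendstoUniformly
      (fun (t x : ℝ≥0) => (transition b t (ρ t) f x - f x) / (t : ℝ)) L (𝓝[>] 0) := by
    rw [Metric.tendstoUniformly_iff]
    intro ε hε
    filter_upwards [hρ.eventually_abs_sub_le hf hμ_tail hfin (half_pos hε)] with t ht x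
    rw [dist_comm, Real.dist_eq]
    exact (ht x).trans_lt (half_lt_self hε)
  have hq : ∀ t : ℝ≥0, (fun x => (transition b t (ρ t) f x - f x) / (t : ℝ)) =
      ((t : ℝ)⁻¹ • (transition b t (ρ t) f - f) : C₀(ℝ≥0, ℝ)) := fun t => by
    funext x
    simp [div_eq_inv_mul]
  have hcont : Continuous L := hunif.continuous (Eventually.frequently (Eventually.of_forall
    fun t => by rw [hq]; exact map_continuous _))
  have hzero : Tendsto L (cocompact ℝ≥0) (𝓝 0) := by
    refine hunif.tendsto_of_eventually_tendsto (Eventually.of_forall fun t => ?_)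
      tendsto_const_nhds
    rw [hq]
    exact zero_at_infty _
  exact ⟨⟨⟨L, hcont⟩, hzero⟩, mem_infinitesimalGraph_iff.2 hunif, fun x => rfl⟩

end Generator

end ESN

namespace ESN

/-! ### Functions with a prescribed derivative -/

theorem exists_hasNiceDeriv_of_integrable {h : ℝ → ℝ} (hc : Continuous h) (h0 : ∀ x ≤ 0, h x = 0)
    (hlim : Tendsto h atTop (𝓝 0)) (hint : IntegrableOn h (Ioi 0)) :
    ∃ f : C₀(ℝ≥0, ℝ), HasNiceDeriv f h := by
  set F : ℝ → ℝ := fun x => (∫ v in (0 : ℝ)..x, h v) - ∫ v in Ioi 0, h v with hF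
  have hd : ∀ x, HasDerivAt F (h x) x := fun x =>
    (hc.integral_hasStrictDerivAt 0 x).hasDerivAt.sub_const _
  have hFc : Continuous F := continuous_iff_continuousAt.2 fun x => (hd x).continuousAt
  have hFlim : Tendsto F atTop (𝓝 0) := by
    have := (intervalIntegral_tendsto_integral_Ioi 0 hint tendsto_id).sub_const (∫ v in Ioi 0, h v)
    rwa [sub_self] at this
  have hF0 : ∀ x ≤ 0, F x = F 0 := fun x hx => by
    have : ∫ v in (0 : ℝ)..x, h v = ∫ v in (0 : ℝ)..x, (0 : ℝ) :=
      intervalIntegral.integral_congr fun v hv => h0 v (by rw [uIcc_of_ge hx] at hv; exact hv.2)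
    simp only [hF, this, intervalIntegral.integral_zero, intervalIntegral.integral_same]
  refine ⟨⟨⟨fun x : ℝ≥0 => F x, hFc.comp NNReal.continuous_coe⟩, ?_⟩, hc, h0, hlim, fun x => ?_⟩
  · rw [cocompact_eq_atTop]
    exact hFlim.comp (NNReal.tendsto_coe_atTop.2 tendsto_id)
  · have : toRealFun ⟨⟨fun x : ℝ≥0 => F x, hFc.comp NNReal.continuous_coe⟩, by
        rw [cocompact_eq_atTop]; exact hFlim.comp (NNReal.tendsto_coe_atTop.2 tendsto_id)⟩ = F := by
      funext y
      change F (y.toNNReal : ℝ) = F y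
      rw [Real.coe_toNNReal']
      rcases le_total y 0 with hy | hy
      · rw [max_eq_right hy, hF0 y hy]
      · rw [max_eq_left hy]
    rw [this]
    exact hd x

theorem integrableOn_mul_measureReal_of_pos {μ : Measure ℝ} {h : ℝ → ℝ}
    (hμ_tail : ∀ x : ℝ, 0 < x → μ (Ici x) < ∞) {x : ℝ} (hx : 0 < x) (hint : IntegrableOn h (Ioi x)) :
    IntegrableOn (fun v => h v * μ.real (Ioi v)) (Ioi x) := by
  refine hint.mul_bdd (c := μ.real (Ioi x))
    (measurable_measureReal_Ioi μ).aestronglyMeasurable ?_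
  filter_upwards [ae_restrict_mem measurableSet_Ioi] with v hv
  rw [Real.norm_of_nonneg measureReal_nonneg]
  exact measureReal_Ioi_anti hμ_tail hx (le_of_lt hv)

namespace HasNiceDeriv

variable {f : C₀(ℝ≥0, ℝ)} {h : ℝ → ℝ} {μ : Measure ℝ}

theorem integral_Ioi_eq (hf : HasNiceDeriv f h) {x : ℝ} (hint : IntegrableOn h (Ioi x)) :
    ∫ v in Ioi x, h v = -toRealFun f x := by
  rw [integral_Ioi_of_hasDerivAt_of_tendsto' (fun y _ => hf.hasDerivAt y) hint
    (tendsto_toRealFun_atTop f), zero_sub]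

theorem jumpPart_eq_integral_Ioi [SFinite μ] (hf : HasNiceDeriv f h)
    (hμ_tail : ∀ x : ℝ, 0 < x → μ (Ici x) < ∞)
    (hfin : ∫⁻ v in Ioc (0 : ℝ) 1, ‖h v‖ₑ * μ (Ioi v) < ∞) {x : ℝ} (hx : 0 < x)
    (hint : IntegrableOn h (Ioi x)) :
    jumpPart μ (toRealFun f) x = ∫ v in Ioi x, h v * μ.real (Ioi v) := by
  have h1 := intervalIntegral_tendsto_integral_Ioi x
    (integrableOn_mul_measureReal_of_pos hμ_tail hx hint) tendsto_id
  have h2 : Tendsto (fun K => jumpPart μ (toRealFun f) K) atTop (𝓝 0) := by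
    have hm : Tendsto (fun K => 2 * ‖f‖ * μ.real (Ioi K)) atTop (𝓝 0) := by
      have := (ENNReal.tendsto_toReal ENNReal.zero_ne_top).comp (tendsto_measure_Ioi_atTop hμ_tail)
      simpa [Measure.real, Function.comp_def] using this.const_mul (2 * ‖f‖)
    refine squeeze_zero_norm' ?_ hm
    filter_upwards [eventually_gt_atTop 0] with K hK
    exact norm_integral_Ioi_sub_le (fun y _ => abs_toRealFun_le f y)
      (measure_Ioi_lt_top hμ_tail hK)
  have h3 := h1.add h2
  rw [add_zero] at h3
  refine tendsto_nhds_unique (tendsto_const_nhds.congr' ?_) h3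
  filter_upwards [eventually_ge_atTop x] with K hK
  rw [(hf.jumpPart_eq hμ_tail hfin hx.le hK (hx.trans_le hK)).2,
    id, intervalIntegral.integral_of_le hK]

theorem mem_D0 (hf : HasNiceDeriv f h) {δ : ℝ} (hδ : 0 < δ) (h0 : ∀ x ≤ δ, h x = 0) : f ∈ D0 := by
  refine ⟨hf.mem_C10, ⟨δ, hδ.le⟩, hδ, fun x hx => ?_⟩
  have hx' : (x : ℝ) ≤ δ := hx
  have := intervalIntegral.integral_eq_sub_of_hasDerivAt (fun y _ => hf.hasDerivAt y)
    (hf.continuous.intervalIntegrable 0 (x : ℝ))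
  have hz : ∫ v in (0 : ℝ)..x, h v = ∫ v in (0 : ℝ)..x, (0 : ℝ) :=
    intervalIntegral.integral_congr fun v hv => h0 v (by
      rw [uIcc_of_le (NNReal.coe_nonneg x)] at hv; exact hv.2.trans hx')
  rw [hz, intervalIntegral.integral_zero, toRealFun_coe, toRealFun_of_nonpos f le_rfl] at this
  linarith

end HasNiceDeriv

section Domain

variable {μ : Measure ℝ}

theorem lintegral_Ioi_le_Ici (φ : ℝ → ℝ) (s : Set ℝ) :
    ∫⁻ v in s, ‖φ v‖ₑ * μ (Ioi v) ≤ ∫⁻ v in s, ‖φ v‖ₑ * μ (Ici v) :=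
  lintegral_mono fun _ => mul_le_mul_right (measure_mono Ioi_subset_Ici_self) _

theorem ae_measure_Ici_eq_Ioi [SFinite μ] : ∀ᵐ v : ℝ, μ (Ici v) = μ (Ioi v) := by
  have hc : {t : ℝ | 0 < μ {a : ℝ | a = t}}.Countable :=
    Measure.countable_meas_level_set_pos measurable_id
  have := hc.ae_notMem (volume : Measure ℝ)
  filter_upwards [this] with v hv
  have hv0 : μ {v} = 0 := by
    by_contra h
    exact hv (pos_iff_ne_zero.2 h)
  exact measure_congr (Ioi_ae_eq_Ici' hv0).symm

theorem exists_hasNiceDeriv_of_mem_D1 {f : C₀(ℝ≥0, ℝ)} (hf : f ∈ D1 μ) :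
    ∃ φ, HasNiceDeriv f φ ∧ ∫⁻ v in Ioc (0 : ℝ) 1, ‖φ v‖ₑ * μ (Ioi v) < ∞ := by
  obtain ⟨φ, hφ⟩ := exists_hasNiceDeriv hf.1 hf.2.1
  refine ⟨φ, hφ, (lintegral_Ioi_le_Ici φ _).trans_lt (lt_of_eq_of_lt ?_ hf.2.2)⟩
  refine setLIntegral_congr_fun measurableSet_Ioc fun v hv => ?_
  rw [hφ.deriv₀_eq hv.1.le]

theorem HasNiceDeriv.mem_D1 [SFinite μ] {f : C₀(ℝ≥0, ℝ)} {φ : ℝ → ℝ} (hf : HasNiceDeriv f φ)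
    (hfin : ∫⁻ v in Ioc (0 : ℝ) 1, ‖φ v‖ₑ * μ (Ioi v) < ∞) : f ∈ D1 μ := by
  refine ⟨hf.mem_C10, ?_, lt_of_eq_of_lt ?_ hfin⟩
  · rw [hf.deriv₀_eq le_rfl, hf.eq_zero_of_nonpos 0 le_rfl]
  · refine setLIntegral_congr_fun_ae measurableSet_Ioc ?_
    filter_upwards [ae_measure_Ici_eq_Ioi (μ := μ)] with v hv hv'
    rw [hf.deriv₀_eq hv'.1.le, hv]

theorem lintegral_lt_top_of_eq_zero (hμ_tail : ∀ x : ℝ, 0 < x → μ (Ici x) < ∞) {φ : ℝ → ℝ} {C : ℝ}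
    (hC : ∀ v ∈ Ioc (0 : ℝ) 1, |φ v| ≤ C) {δ : ℝ} (hδ : 0 < δ)
    (h0 : ∀ v, 0 < v → v ≤ δ → φ v = 0) :
    ∫⁻ v in Ioc (0 : ℝ) 1, ‖φ v‖ₑ * μ (Ici v) < ∞ := by
  have : ∫⁻ v in Ioc (0 : ℝ) 1, ‖φ v‖ₑ * μ (Ici v) ≤
      ∫⁻ v in Ioc (0 : ℝ) 1, ENNReal.ofReal C * μ (Ici δ) := by
    refine setLIntegral_mono' measurableSet_Ioc fun v hv => ?_
    rcases le_total v δ with h | h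
    · rw [h0 v hv.1 h, enorm_zero, zero_mul]
      exact zero_le
    · gcongr
      rw [← ofReal_norm]
      exact ENNReal.ofReal_le_ofReal (hC v hv)
  refine this.trans_lt ?_
  rw [setLIntegral_const, Real.volume_Ioc]
  exact ENNReal.mul_lt_top (ENNReal.mul_lt_top ENNReal.ofReal_lt_top (hμ_tail δ hδ))
    ENNReal.ofReal_lt_top

theorem D0_subset_D1 (hμ_tail : ∀ x : ℝ, 0 < x → μ (Ici x) < ∞) : D0 ⊆ D1 μ := by
  rintro f ⟨hf, ε, hε, hconst⟩
  have hε' : (0 : ℝ) < ε := hε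
  have hd : ∀ x : ℝ, 0 ≤ x → x < ε → deriv₀ f x = 0 := fun x hx hxε => by
    have hev : toRealFun f =ᶠ[𝓝 x] fun _ => f 0 := by
      filter_upwards [Iio_mem_nhds hxε] with y hy
      refine hconst _ ?_
      rw [Real.toNNReal_le_iff_le_coe]
      exact le_of_lt hy
    have : HasDerivAt (toRealFun f) 0 x := (hasDerivAt_const x (f 0)).congr_of_eventuallyEq hev
    exact this.hasDerivWithinAt.derivWithin (uniqueDiffOn_Ici 0 x hx)
  obtain ⟨φ, hφ⟩ := exists_hasNiceDeriv hf (hd 0 le_rfl hε')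
  obtain ⟨C, -, hC⟩ := hφ.exists_abs_le
  refine ⟨hf, hd 0 le_rfl hε', ?_⟩
  refine lintegral_lt_top_of_eq_zero hμ_tail (C := C) (δ := ε / 2)
    (fun v hv => by rw [hφ.deriv₀_eq hv.1.le]; exact hC v) (by positivity)
    fun v hv hvε => hd v hv.le (by linarith)

end Domain

section Density

variable {μ : Measure ℝ} [SFinite μ] {b : ℝ} {ρ : ℝ≥0 → Measure ℝ}
  [∀ t, IsProbabilityMeasure (ρ t)]

/-- An approximate solution `h` of the derivative of the resolvent equation gives an approximate
solution of the resolvent equation. -/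
theorem IsNoiseFamily.exists_norm_sub_sub_le (hρ : IsNoiseFamily μ b ρ)
    (hμ_tail : ∀ x : ℝ, 0 < x → μ (Ici x) < ∞) {h ψ : ℝ → ℝ} (hc : Continuous h)
    (h0 : ∀ x ≤ 0, h x = 0) (hlim : Tendsto h atTop (𝓝 0)) (hint : IntegrableOn h (Ioi 0))
    (hfin : ∫⁻ v in Ioc (0 : ℝ) 1, ‖h v‖ₑ * μ (Ioi v) < ∞) (hψ : Integrable ψ)
    {ε : ℝ} (hε : 0 ≤ ε)
    (happrox : ∀ x, 0 < x → |b * h x - ∫ v in Ioi x, ((1 + μ.real (Ioi v)) * h v - ψ v)| ≤ ε)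
    {k : C₀(ℝ≥0, ℝ)} (hk : ∀ x : ℝ, 0 < x → |toRealFun k x + ∫ v in Ioi x, ψ v| ≤ ε) :
    ∃ f g, (f, g) ∈ infinitesimalGraph (fun t => transition b t (ρ t)) ∧ HasNiceDeriv f h ∧
      ‖f - g - k‖ ≤ 2 * ε := by
  obtain ⟨f, hf⟩ := exists_hasNiceDeriv_of_integrable hc h0 hlim hint
  obtain ⟨g, hfg, hg⟩ := hρ.exists_mem_infinitesimalGraph hf hμ_tail hfin
  refine ⟨f, g, hfg, hf, ?_⟩
  rw [norm_le_iff_forall_abs_le _ (by linarith)]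
  have hpos : ∀ x : ℝ≥0, 0 < x → |(f - g - k) x| ≤ 2 * ε := by
    intro x hx
    have hx' : (0 : ℝ) < x := hx
    have hintx : IntegrableOn h (Ioi (x : ℝ)) := hint.mono_set (Ioi_subset_Ioi hx'.le)
    have h1 := hf.integral_Ioi_eq hintx
    have h2 := hf.jumpPart_eq_integral_Ioi hμ_tail hfin hx' hintx
    have h3 := integrableOn_mul_measureReal_of_pos hμ_tail hx' hintx
    have h4 := happrox x hx'
    have h5 := hk x hx'
    have h6 : ∫ v in Ioi (x : ℝ), ((1 + μ.real (Ioi v)) * h v - ψ v) =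
        (∫ v in Ioi (x : ℝ), h v) + (∫ v in Ioi (x : ℝ), h v * μ.real (Ioi v)) -
          ∫ v in Ioi (x : ℝ), ψ v := by
      have h34 : IntegrableOn (fun v => h v + h v * μ.real (Ioi v)) (Ioi (x : ℝ)) := hintx.add h3
      rw [← integral_add hintx h3, ← integral_sub h34 hψ.integrableOn]
      refine integral_congr_ae (Eventually.of_forall fun v => ?_)
      simp only
      ring
    have h7 : (f - g - k) x = (b * h x - ∫ v in Ioi (x : ℝ), ((1 + μ.real (Ioi v)) * h v - ψ v)) -
        (toRealFun k x + ∫ v in Ioi (x : ℝ), ψ v) := by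
      rw [h6, h1, ← h2, ZeroAtInftyContinuousMap.sub_apply, ZeroAtInftyContinuousMap.sub_apply,
        hg x, toRealFun_coe, toRealFun_coe]
      ring
    rw [h7]
    refine (abs_sub _ _).trans ?_
    linarith
  intro x
  rcases eq_or_ne x 0 with rfl | hx
  · have hcl : IsClosed {x : ℝ≥0 | |(f - g - k) x| ≤ 2 * ε} :=
      isClosed_le (map_continuous (f - g - k)).abs continuous_const
    have hsub : closure (Ioi (0 : ℝ≥0)) ⊆ {x : ℝ≥0 | |(f - g - k) x| ≤ 2 * ε} :=
      closure_minimal (fun x hx => hpos x hx) hcl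
    rw [closure_Ioi] at hsub
    exact hsub self_mem_Ici
  · exact hpos x (pos_iff_ne_zero.2 hx)

end Density

end ESN

namespace ESN

/-! ### Approximation by antiderivatives -/

theorem abs_sub_clamp_sub_le {ε : ℝ} (hε : 0 ≤ ε) (y : ℝ) :
    |y - max (-ε) (min ε y) - y| ≤ ε := by
  rw [sub_sub_cancel_left, abs_neg, abs_le]
  exact ⟨le_max_left _ _, max_le (by linarith) (min_le_left _ _)⟩

theorem sub_clamp_eq_zero {ε y : ℝ} (hy : |y| ≤ ε) : y - max (-ε) (min ε y) = 0 := by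
  obtain ⟨h1, h2⟩ := abs_le.1 hy
  rw [min_eq_right h2, max_eq_right h1, sub_self]

theorem integrable_of_continuous_of_eq_zero {ψ : ℝ → ℝ} (hψ : Continuous ψ) {δ K : ℝ}
    (h0 : ∀ v ≤ δ, ψ v = 0) (hK : ∀ v, K ≤ v → ψ v = 0) : Integrable ψ := by
  refine hψ.integrable_of_hasCompactSupport ?_
  refine HasCompactSupport.intro (isCompact_Icc (a := δ) (b := K)) fun v hv => ?_
  by_cases h : v ≤ δ
  · exact h0 v h
  · refine hK v ?_
    by_contra h'
    exact hv ⟨(not_le.1 h).le, (not_le.1 h').le⟩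

/-- Every function of `C₀(ℝ≥0, ℝ)` is a uniform limit of functions whose derivative is continuous
and compactly supported in `(0, ∞)`. -/
theorem exists_integral_Ioi_approx (k : C₀(ℝ≥0, ℝ)) {ε : ℝ} (hε : 0 < ε) :
    ∃ (ψ : ℝ → ℝ) (δ K : ℝ), Continuous ψ ∧ 0 < δ ∧ (∀ v ≤ δ, ψ v = 0) ∧
      (∀ v, K ≤ v → ψ v = 0) ∧ ∀ x : ℝ, |toRealFun k x + ∫ v in Ioi x, ψ v| ≤ ε := by
  obtain ⟨r, hr, hunif⟩ := Metric.uniformContinuous_iff.1 (uniformContinuous_toRealFun k) (ε / 2)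
    (half_pos hε)
  set δ := r / 4 with hδ
  have hδ0 : 0 < δ := by positivity
  set κ : ℝ → ℝ := fun x => toRealFun k (x - 2 * δ) -
    max (-(ε / 2)) (min (ε / 2) (toRealFun k (x - 2 * δ))) with hκ
  have hkc := continuous_toRealFun k
  have hκc : Continuous κ := by fun_prop
  have hκ0 : ∀ x ≤ 2 * δ, κ x = κ 0 := fun x hx => by
    simp only [hκ]
    rw [toRealFun_of_nonpos k (by linarith), toRealFun_of_nonpos k (by linarith)]
  obtain ⟨K, hK⟩ : ∃ K : ℝ, ∀ x, K ≤ x → κ x = 0 := by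
    have h1 := (tendsto_toRealFun_atTop k).eventually (Metric.ball_mem_nhds 0 (half_pos hε))
    obtain ⟨K, hK⟩ := h1.exists_forall_of_atTop
    refine ⟨K + 2 * δ, fun x hx => sub_clamp_eq_zero ?_⟩
    have := hK (x - 2 * δ) (by linarith)
    rw [dist_zero_right] at this
    exact this.le
  have hκk : ∀ x y, x ≤ y → y ≤ x + δ → |κ y - toRealFun k x| ≤ ε := by
    intro x y hxy hyx
    have h1 := abs_sub_clamp_sub_le (half_pos hε).le (toRealFun k (y - 2 * δ))
    have h2 : |toRealFun k (y - 2 * δ) - toRealFun k x| ≤ ε / 2 :=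
      (hunif (a := y - 2 * δ) (b := x) (by
        rw [Real.dist_eq, abs_lt]; constructor <;> linarith)).le
    have h3 := abs_add_le (κ y - toRealFun k (y - 2 * δ)) (toRealFun k (y - 2 * δ) - toRealFun k x)
    rw [sub_add_sub_cancel] at h3
    linarith
  set g : ℝ → ℝ := fun x => δ⁻¹ * ∫ v in x..(x + δ), κ v with hg
  set ψ : ℝ → ℝ := fun x => δ⁻¹ * (κ (x + δ) - κ x) with hψ
  have hψc : Continuous ψ := by fun_prop
  have hψ0 : ∀ v ≤ δ, ψ v = 0 := fun v hv => by
    simp only [hψ]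
    rw [hκ0 (v + δ) (by linarith), hκ0 v (by linarith), sub_self, mul_zero]
  have hψK : ∀ v, K ≤ v → ψ v = 0 := fun v hv => by
    simp only [hψ]
    rw [hK _ (by linarith), hK _ hv, sub_self, mul_zero]
  have hgd : ∀ x, HasDerivAt g (ψ x) x := by
    intro x
    have hP : ∀ y, HasDerivAt (fun y => ∫ v in (0 : ℝ)..y, κ v) (κ y) y := fun y =>
      (hκc.integral_hasStrictDerivAt 0 y).hasDerivAt
    have h1 := (((hP (x + δ)).comp_add_const x δ).sub (hP x)).const_mul δ⁻¹
    refine h1.congr_of_eventuallyEq (Eventually.of_forall fun y => ?_)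
    simp only [hg, Pi.sub_apply]
    rw [intervalIntegral.integral_interval_sub_left (hκc.intervalIntegrable _ _)
      (hκc.intervalIntegrable _ _)]
  have hglim : Tendsto g atTop (𝓝 0) := by
    refine tendsto_const_nhds.congr' ?_
    filter_upwards [eventually_ge_atTop K] with x hx
    have : ∫ v in x..(x + δ), κ v = ∫ v in x..(x + δ), (0 : ℝ) :=
      intervalIntegral.integral_congr fun v hv => hK v (by
        rw [uIcc_of_le (by linarith)] at hv; exact hx.trans hv.1)
    simp only [hg, this, intervalIntegral.integral_zero, mul_zero]
  have hψint : ∀ x, IntegrableOn ψ (Ioi x) := fun x =>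
    (integrable_of_continuous_of_eq_zero hψc hψ0 hψK).integrableOn
  refine ⟨ψ, δ, K, hψc, hδ0, hψ0, hψK, fun x => ?_⟩
  rw [integral_Ioi_of_hasDerivAt_of_tendsto' (fun y _ => hgd y) (hψint x) hglim, zero_sub,
    ← sub_eq_add_neg, abs_sub_comm]
  have h1 : g x - toRealFun k x = δ⁻¹ * ∫ v in x..(x + δ), (κ v - toRealFun k x) := by
    rw [intervalIntegral.integral_sub (hκc.intervalIntegrable _ _) intervalIntegrable_const,
      intervalIntegral.integral_const, smul_eq_mul, add_sub_cancel_left, mul_sub, ← mul_assoc,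
      inv_mul_cancel₀ hδ0.ne', one_mul]
  have h2 : ‖∫ v in x..(x + δ), (κ v - toRealFun k x)‖ ≤ ε * |x + δ - x| := by
    refine intervalIntegral.norm_integral_le_of_norm_le_const fun v hv => ?_
    rw [uIoc_of_le (by linarith)] at hv
    exact hκk x v hv.1.le hv.2
  rw [add_sub_cancel_left, abs_of_pos hδ0, Real.norm_eq_abs] at h2
  rw [h1, abs_mul, abs_of_pos (inv_pos.2 hδ0), inv_mul_le_iff₀ hδ0]
  linarith

/-! ### The resolvent equation without drift -/

/-- Compactly supported approximate solutions of `(1 + μ(v, ∞)) h = ψ`. -/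
theorem exists_approx_resolvent_of_zero_drift {μ : Measure ℝ}
    (hμ_tail : ∀ x : ℝ, 0 < x → μ (Ici x) < ∞) {ψ : ℝ → ℝ} {δ K ε : ℝ} (hψ : Continuous ψ)
    (hδ : 0 < δ) (hψ0 : ∀ v ≤ δ, ψ v = 0) (hψK : ∀ v, K ≤ v → ψ v = 0) (hε : 0 < ε) :
    ∃ (h : ℝ → ℝ), Continuous h ∧ HasCompactSupport h ∧ (∀ v ≤ δ / 2, h v = 0) ∧
      ∀ x, 0 < x → |∫ v in Ioi x, ((1 + μ.real (Ioi v)) * h v - ψ v)| ≤ ε := by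
  set a : ℝ → ℝ := fun v => 1 + μ.real (Ioi v) with ha
  have ha1 : ∀ v, 1 ≤ a v := fun v => le_add_of_nonneg_right measureReal_nonneg
  have ham : Measurable a := (measurable_measureReal_Ioi μ).const_add 1
  set A := a (δ / 2) with hA
  have hA0 : 0 < A := one_pos.trans_le (ha1 _)
  have hψi := integrable_of_continuous_of_eq_zero hψ hψ0 hψK
  have hφi : Integrable fun v => ψ v / a v := by
    refine hψi.mono (hψ.measurable.div ham).aestronglyMeasurable (Eventually.of_forall fun v => ?_)
    rw [norm_div, Real.norm_of_nonneg (zero_le_one.trans (ha1 v))]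
    exact div_le_self (norm_nonneg _) (ha1 v)
  obtain ⟨h₀, hsupp, happ, hcont, hint⟩ :=
    hφi.exists_hasCompactSupport_integral_sub_le (div_pos hε hA0)
  set χ : ℝ → ℝ := fun v => max 0 (min 1 (2 / δ * v - 1)) with hχ
  have hχ0 : ∀ v, 0 ≤ χ v := fun v => le_max_left _ _
  have hχ1 : ∀ v, χ v ≤ 1 := fun v => max_le zero_le_one (min_le_left _ _)
  have hχlow : ∀ v ≤ δ / 2, χ v = 0 := fun v hv => by
    refine max_eq_left ((min_le_right _ _).trans ?_)
    rw [div_mul_eq_mul_div, sub_nonpos, div_le_one hδ]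
    linarith
  have hχhigh : ∀ v, δ ≤ v → χ v = 1 := fun v hv => by
    have : 1 ≤ 2 / δ * v - 1 := by
      rw [div_mul_eq_mul_div, le_sub_iff_add_le, le_div_iff₀ hδ]
      linarith
    simp only [hχ]
    rw [min_eq_left this, max_eq_right zero_le_one]
  have hχc : Continuous χ := by fun_prop
  refine ⟨fun v => χ v * h₀ v, hχc.mul hcont, hsupp.mul_left,
    fun v hv => by simp only [hχlow v hv, zero_mul], fun x hx => ?_⟩
  have hpt : ∀ v, ‖a v * (χ v * h₀ v) - ψ v‖ ≤ A * ‖ψ v / a v - h₀ v‖ := by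
    intro v
    have hav : 0 < a v := one_pos.trans_le (ha1 v)
    have e : a v * (χ v * h₀ v) - ψ v = -(a v * χ v * (ψ v / a v - h₀ v)) := by
      have : χ v * ψ v = ψ v := by
        rcases le_total v δ with hv | hv
        · rw [hψ0 v hv, mul_zero]
        · rw [hχhigh v hv, one_mul]
      have h2 : a v * χ v * (ψ v / a v) = χ v * ψ v := by field_simp
      rw [mul_sub, h2, this]
      ring
    rw [e, norm_neg, norm_mul]
    refine mul_le_mul_of_nonneg_right ?_ (norm_nonneg _)
    rw [Real.norm_of_nonneg (mul_nonneg hav.le (hχ0 v))]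
    rcases le_total v (δ / 2) with hv | hv
    · rw [hχlow v hv, mul_zero]; exact hA0.le
    · refine (mul_le_of_le_one_right hav.le (hχ1 v)).trans ?_
      exact add_le_add_right (measureReal_Ioi_anti hμ_tail (half_pos hδ) hv) 1
  have hgi : Integrable fun v => A * ‖ψ v / a v - h₀ v‖ := (hφi.sub hint).norm.const_mul A
  calc |∫ v in Ioi x, (a v * (χ v * h₀ v) - ψ v)|
      ≤ ∫ v in Ioi x, A * ‖ψ v / a v - h₀ v‖ :=
        norm_integral_le_of_norm_le hgi.integrableOn (Eventually.of_forall hpt)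
    _ ≤ ∫ v, A * ‖ψ v / a v - h₀ v‖ := setIntegral_le_integral hgi
        (Eventually.of_forall fun v => mul_nonneg hA0.le (norm_nonneg _))
    _ ≤ ε := by
        rw [integral_const_mul, ← le_div_iff₀' hA0]
        exact happ

end ESN

namespace ESN

/-! ### The resolvent equation with drift -/

/-- The rate `1 + μ(v, ∞)` of the resolvent equation. -/
noncomputable def rate (μ : Measure ℝ) (v : ℝ) : ℝ := 1 + μ.real (Ioi v)

/-- The primitive of the rate that vanishes at `δ`. -/
noncomputable def ratePrimitive (μ : Measure ℝ) (δ x : ℝ) : ℝ := ∫ v in δ..x, rate μ v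

section Rate

variable {μ : Measure ℝ}

theorem one_le_rate (v : ℝ) : 1 ≤ rate μ v := le_add_of_nonneg_right measureReal_nonneg

theorem rate_pos (v : ℝ) : 0 < rate μ v := one_pos.trans_le (one_le_rate v)

theorem measurable_rate : Measurable (rate μ) := (measurable_measureReal_Ioi μ).const_add 1

theorem antitoneOn_rate (hμ_tail : ∀ x : ℝ, 0 < x → μ (Ici x) < ∞) :
    AntitoneOn (rate μ) (Ioi 0) := fun _ hu _ _ huv =>
  add_le_add_right (measureReal_Ioi_anti hμ_tail hu huv) 1

theorem uIcc_subset_Ioi {x y : ℝ} (hx : 0 < x) (hy : 0 < y) : uIcc x y ⊆ Ioi 0 := fun _ hv =>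
  (lt_min hx hy).trans_le hv.1

theorem intervalIntegrable_rate (hμ_tail : ∀ x : ℝ, 0 < x → μ (Ici x) < ∞) {x y : ℝ} (hx : 0 < x)
    (hy : 0 < y) : IntervalIntegrable (rate μ) volume x y :=
  ((antitoneOn_rate hμ_tail).mono (uIcc_subset_Ioi hx hy)).intervalIntegrable

theorem continuousWithinAt_rate (hμ_tail : ∀ x : ℝ, 0 < x → μ (Ici x) < ∞) {x : ℝ} (hx : 0 < x) :
    ContinuousWithinAt (rate μ) (Ioi x) x := by
  have h1 : Tendsto (fun v => μ (Ioi v)) (𝓝[>] x) (𝓝 (μ (Ioi x))) := by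
    refine tendsto_order.2 ⟨fun c hc => ?_, fun c hc => ?_⟩
    · have hU : (⋃ n : ℕ, Ioi (x + 1 / ((n : ℝ) + 1))) = Ioi x := by
        ext y
        simp only [mem_iUnion, mem_Ioi]
        constructor
        · rintro ⟨n, hn⟩
          exact (lt_add_of_pos_right x Nat.one_div_pos_of_nat).trans hn
        · intro hy
          obtain ⟨n, hn⟩ := exists_nat_one_div_lt (sub_pos.2 hy)
          exact ⟨n, by linarith⟩
      have hmono : Monotone fun n : ℕ => Ioi (x + 1 / ((n : ℝ) + 1)) := fun n m hnm =>
        Ioi_subset_Ioi (by gcongr)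
      have hlim := tendsto_measure_iUnion_atTop (μ := μ) hmono
      rw [hU] at hlim
      obtain ⟨n, hn⟩ := (hlim.eventually (lt_mem_nhds hc)).exists
      filter_upwards [Ioo_mem_nhdsGT (lt_add_of_pos_right x
        (Nat.one_div_pos_of_nat (n := n) (α := ℝ)))] with v hv
      exact lt_of_lt_of_le hn (measure_mono (Ioi_subset_Ioi hv.2.le))
    · filter_upwards [self_mem_nhdsWithin] with v hv
      exact (measure_mono (Ioi_subset_Ioi (le_of_lt hv))).trans_lt hc
  exact ((ENNReal.tendsto_toReal (measure_Ioi_lt_top hμ_tail hx).ne).comp h1).const_add 1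

theorem hasDerivWithinAt_ratePrimitive (hμ_tail : ∀ x : ℝ, 0 < x → μ (Ici x) < ∞) {δ x : ℝ}
    (hδ : 0 < δ) (hx : 0 < x) :
    HasDerivWithinAt (ratePrimitive μ δ) (rate μ x) (Ioi x) x :=
  (intervalIntegral.integral_hasDerivWithinAt_right (s := Ici x) (t := Ioi x)
    (intervalIntegrable_rate hμ_tail hδ hx)
    measurable_rate.stronglyMeasurable.stronglyMeasurableAtFilter
    (continuousWithinAt_rate hμ_tail hx)).mono Ioi_subset_Ici_self

theorem continuousOn_ratePrimitive (hμ_tail : ∀ x : ℝ, 0 < x → μ (Ici x) < ∞) {δ : ℝ}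
    (hδ : 0 < δ) : ContinuousOn (ratePrimitive μ δ) (Ioi 0) := by
  intro x hx
  have hx' : 0 < x := hx
  have h1 : 0 < min (x / 2) δ := lt_min (half_pos hx') hδ
  have h2 : 0 < max (x + 1) δ := lt_max_of_lt_right hδ
  have hle : min (x / 2) δ ≤ max (x + 1) δ := (min_le_right _ _).trans (le_max_right _ _)
  have hc := intervalIntegral.continuousOn_primitive_interval' (a := δ)
    (intervalIntegrable_rate hμ_tail h1 h2)
    (by rw [uIcc_of_le hle]; exact ⟨min_le_right _ _, le_max_right _ _⟩)
  rw [uIcc_of_le hle] at hc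
  refine (hc.continuousAt (Icc_mem_nhds ?_ ?_)).continuousWithinAt
  · exact (min_le_left _ _).trans_lt (half_lt_self hx')
  · exact (lt_add_one x).trans_le (le_max_left _ _)

theorem ratePrimitive_sub (hμ_tail : ∀ x : ℝ, 0 < x → μ (Ici x) < ∞) {δ x y : ℝ}
    (hδ : 0 < δ) (hx : 0 < x) (hy : 0 < y) :
    ratePrimitive μ δ y - ratePrimitive μ δ x = ∫ v in x..y, rate μ v :=
  intervalIntegral.integral_interval_sub_left (intervalIntegrable_rate hμ_tail hδ hy)
    (intervalIntegrable_rate hμ_tail hδ hx)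

theorem sub_le_ratePrimitive_sub (hμ_tail : ∀ x : ℝ, 0 < x → μ (Ici x) < ∞) {δ x y : ℝ}
    (hδ : 0 < δ) (hx : 0 < x) (hxy : x ≤ y) :
    y - x ≤ ratePrimitive μ δ y - ratePrimitive μ δ x := by
  rw [ratePrimitive_sub hμ_tail hδ hx (hx.trans_le hxy)]
  have := intervalIntegral.integral_mono_on hxy (intervalIntegrable_const (c := (1 : ℝ)))
    (intervalIntegrable_rate hμ_tail hx (hx.trans_le hxy)) fun v _ => one_le_rate v
  simpa using this

end Rate

/-- The solution of `b h' + rate * h = ψ` that vanishes at `x₁`. -/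
noncomputable def linearSolution (μ : Measure ℝ) (b δ x₁ : ℝ) (ψ : ℝ → ℝ) (x : ℝ) : ℝ :=
  b⁻¹ * Real.exp (-(ratePrimitive μ δ x) / b) *
    ∫ v in x₁..x, Real.exp (ratePrimitive μ δ v / b) * ψ v

section Linear

variable {μ : Measure ℝ} {b δ x₁ : ℝ} {ψ : ℝ → ℝ}

theorem continuous_exp_ratePrimitive_mul (hμ_tail : ∀ x : ℝ, 0 < x → μ (Ici x) < ∞) (hδ : 0 < δ)
    (hψ : Continuous ψ) (hψ0 : ∀ v ≤ δ, ψ v = 0) :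
    Continuous fun v => Real.exp (ratePrimitive μ δ v / b) * ψ v := by
  refine continuous_iff_continuousAt.2 fun x => ?_
  rcases lt_or_ge x δ with hx | hx
  · have : (fun _ => (0 : ℝ)) =ᶠ[𝓝 x] fun v => Real.exp (ratePrimitive μ δ v / b) * ψ v := by
      filter_upwards [Iio_mem_nhds hx] with v hv
      rw [hψ0 v (le_of_lt hv), mul_zero]
    exact continuousAt_const.congr this
  · have := (continuousOn_ratePrimitive hμ_tail hδ).continuousAt (Ioi_mem_nhds (hδ.trans_le hx))
    exact (Real.continuous_exp.continuousAt.comp (this.div_const b)).mul hψ.continuousAt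

theorem continuousOn_linearSolution (hμ_tail : ∀ x : ℝ, 0 < x → μ (Ici x) < ∞) (hδ : 0 < δ)
    (hψ : Continuous ψ) (hψ0 : ∀ v ≤ δ, ψ v = 0) :
    ContinuousOn (linearSolution μ b δ x₁ ψ) (Ioi 0) := by
  have h1 := continuousOn_ratePrimitive hμ_tail hδ
  have h2 : Continuous fun x => ∫ v in x₁..x, Real.exp (ratePrimitive μ δ v / b) * ψ v :=
    intervalIntegral.continuous_primitive
      (fun _ _ => (continuous_exp_ratePrimitive_mul hμ_tail hδ hψ hψ0).intervalIntegrable _ _) x₁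
  exact (continuousOn_const.mul (Real.continuous_exp.comp_continuousOn (h1.neg.div_const b))).mul
    h2.continuousOn

theorem linearSolution_sub (hμ_tail : ∀ x : ℝ, 0 < x → μ (Ici x) < ∞) (hb : b ≠ 0) (hδ : 0 < δ)
    (hψ : Continuous ψ) (hψ0 : ∀ v ≤ δ, ψ v = 0) {x y : ℝ} (hx : 0 < x) (hxy : x ≤ y) :
    IntervalIntegrable (fun v => rate μ v * linearSolution μ b δ x₁ ψ v) volume x y ∧
    b * linearSolution μ b δ x₁ ψ y - b * linearSolution μ b δ x₁ ψ x =
      ∫ v in x..y, (ψ v - rate μ v * linearSolution μ b δ x₁ ψ v) := by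
  have hc := (continuousOn_linearSolution (b := b) (x₁ := x₁) hμ_tail hδ hψ hψ0).mono
    (uIcc_subset_Ioi hx (hx.trans_le hxy))
  have hi : IntervalIntegrable (fun v => rate μ v * linearSolution μ b δ x₁ ψ v) volume x y :=
    (intervalIntegrable_rate hμ_tail hx (hx.trans_le hxy)).mul_continuousOn hc
  refine ⟨hi, ?_⟩
  rw [intervalIntegral.integral_eq_sub_of_hasDeriv_right_of_le hxy
    (f := fun v => b * linearSolution μ b δ x₁ ψ v)]
  · rw [uIcc_of_le hxy] at hc
    exact continuousOn_const.mul hc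
  · intro v hv
    have hv0 : 0 < v := hx.trans hv.1
    have h1 := ((hasDerivWithinAt_ratePrimitive hμ_tail hδ hv0).neg.div_const b).exp
    have h2 : HasDerivWithinAt (fun x => ∫ v in x₁..x, Real.exp (ratePrimitive μ δ v / b) * ψ v)
        (Real.exp (ratePrimitive μ δ v / b) * ψ v) (Ioi v) v :=
      ((continuous_exp_ratePrimitive_mul hμ_tail hδ hψ hψ0).integral_hasStrictDerivAt
        x₁ v).hasDerivAt.hasDerivWithinAt
    have h3 := ((h1.const_mul b⁻¹).mul h2).const_mul b
    refine h3.congr_deriv ?_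
    have h4 : Real.exp (-(ratePrimitive μ δ v) / b) * Real.exp (ratePrimitive μ δ v / b) = 1 := by
      rw [← Real.exp_add, neg_div, neg_add_cancel, Real.exp_zero]
    simp only [linearSolution, Pi.neg_apply]
    generalize Real.exp (-(ratePrimitive μ δ v) / b) = e₁ at h4 ⊢
    generalize Real.exp (ratePrimitive μ δ v / b) = e₂ at h4 ⊢
    field_simp
    linear_combination (b * ψ v) * h4
  · exact (hψ.intervalIntegrable _ _).sub hi

/-- Passing to the limit in the integrated equation. -/
theorem linearSolution_eq_integral_Ioi (hμ_tail : ∀ x : ℝ, 0 < x → μ (Ici x) < ∞) (hb : b ≠ 0)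
    (hδ : 0 < δ) (hψ : Continuous ψ) (hψ0 : ∀ v ≤ δ, ψ v = 0) (hψi : Integrable ψ)
    (hlim : Tendsto (linearSolution μ b δ x₁ ψ) atTop (𝓝 0)) {x : ℝ} (hx : 0 < x)
    (hint : IntegrableOn (linearSolution μ b δ x₁ ψ) (Ioi x)) :
    b * linearSolution μ b δ x₁ ψ x =
      ∫ v in Ioi x, (rate μ v * linearSolution μ b δ x₁ ψ v - ψ v) := by
  have hi : IntegrableOn (fun v => rate μ v * linearSolution μ b δ x₁ ψ v) (Ioi x) := by
    refine (hint.add (integrableOn_mul_measureReal_of_pos hμ_tail hx hint)).congr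
      (Eventually.of_forall fun v => ?_)
    simp only [Pi.add_apply, rate]
    ring
  have h1 := intervalIntegral_tendsto_integral_Ioi x (hi.sub hψi.integrableOn) tendsto_id
  have h2 : Tendsto (fun y => b * linearSolution μ b δ x₁ ψ x - b * linearSolution μ b δ x₁ ψ y)
      atTop (𝓝 (b * linearSolution μ b δ x₁ ψ x)) := by
    simpa using (hlim.const_mul b).const_sub (b * linearSolution μ b δ x₁ ψ x)
  refine tendsto_nhds_unique (h2.congr' ?_) h1
  filter_upwards [eventually_ge_atTop x] with y hy
  rw [← neg_sub, (linearSolution_sub hμ_tail hb hδ hψ hψ0 hx hy).2, ←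
    intervalIntegral.integral_neg]
  simp only [neg_sub, Pi.sub_apply, id]

end Linear

end ESN

namespace ESN

/-! ### Dense range -/

section PositiveDrift

variable {μ : Measure ℝ} {b δ K : ℝ} {ψ : ℝ → ℝ}

theorem linearSolution_eq_of_le (hψ0 : ∀ v ≤ δ, ψ v = 0) (hμ_tail : ∀ x : ℝ, 0 < x → μ (Ici x) < ∞)
    (hδ : 0 < δ) (hψ : Continuous ψ) (x₁ : ℝ) {x : ℝ} (hx : x ≤ δ) :
    linearSolution μ b δ x₁ ψ x = b⁻¹ * Real.exp (-(ratePrimitive μ δ x) / b) *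
      ∫ v in x₁..δ, Real.exp (ratePrimitive μ δ v / b) * ψ v := by
  have hN := continuous_exp_ratePrimitive_mul (b := b) hμ_tail hδ hψ hψ0
  rw [linearSolution, ← intervalIntegral.integral_add_adjacent_intervals
    (hN.intervalIntegrable x₁ δ) (hN.intervalIntegrable δ x)]
  have : ∫ v in δ..x, Real.exp (ratePrimitive μ δ v / b) * ψ v = ∫ v in δ..x, (0 : ℝ) :=
    intervalIntegral.integral_congr fun v hv => by
      rw [uIcc_of_ge hx] at hv
      simp only [hψ0 v hv.2, mul_zero]
  rw [this, intervalIntegral.integral_zero, add_zero]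

theorem exists_solution_of_pos (hμ_tail : ∀ x : ℝ, 0 < x → μ (Ici x) < ∞) (hb : 0 < b)
    (hψ : Continuous ψ) (hδ : 0 < δ) (hψ0 : ∀ v ≤ δ, ψ v = 0) (hψK : ∀ v, K ≤ v → ψ v = 0) :
    ∃ h : ℝ → ℝ, Continuous h ∧ (∀ v ≤ δ, h v = 0) ∧ Tendsto h atTop (𝓝 0) ∧
      IntegrableOn h (Ioi 0) ∧
      ∀ x, 0 < x → b * h x = ∫ v in Ioi x, ((1 + μ.real (Ioi v)) * h v - ψ v) := by
  set l := linearSolution μ b δ δ ψ with hl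
  set h : ℝ → ℝ := (Ioi 0).indicator l with hh
  have hlow : ∀ v ≤ δ, h v = 0 := fun v hv => by
    by_cases h0 : v ∈ Ioi (0 : ℝ)
    · rw [hh, indicator_of_mem h0, hl, linearSolution_eq_of_le hψ0 hμ_tail hδ hψ δ hv,
        intervalIntegral.integral_same, mul_zero]
    · rw [hh, indicator_of_notMem h0]
  have hpos : ∀ v, 0 < v → h v = l v := fun v hv => indicator_of_mem (mem_Ioi.2 hv) _
  have hcont : Continuous h := by
    refine continuous_iff_continuousAt.2 fun x => ?_
    rcases lt_or_ge x δ with hx | hx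
    · have : (fun _ => (0 : ℝ)) =ᶠ[𝓝 x] h := by
        filter_upwards [Iio_mem_nhds hx] with v hv using (hlow v (le_of_lt hv)).symm
      exact continuousAt_const.congr this
    · have hx0 := hδ.trans_le hx
      have := (continuousOn_linearSolution (b := b) (x₁ := δ) hμ_tail hδ hψ hψ0).continuousAt
        (Ioi_mem_nhds hx0)
      refine this.congr ?_
      filter_upwards [Ioi_mem_nhds hx0] with v hv using (hpos v hv).symm
  have hNc := continuous_exp_ratePrimitive_mul (b := b) hμ_tail hδ hψ hψ0
  have hNi : Integrable fun v => Real.exp (ratePrimitive μ δ v / b) * ψ v :=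
    integrable_of_continuous_of_eq_zero hNc (δ := δ) (K := K)
      (fun v hv => by rw [hψ0 v hv, mul_zero]) fun v hv => by rw [hψK v hv, mul_zero]
  set J := ∫ v, ‖Real.exp (ratePrimitive μ δ v / b) * ψ v‖ with hJ
  have hJ0 : 0 ≤ J := integral_nonneg fun v => norm_nonneg _
  have hbound : ∀ x, 0 < x → ‖h x‖ ≤ b⁻¹ * Real.exp (δ / b) * J * Real.exp (-b⁻¹ * x) := by
    intro x hx
    rcases le_total x δ with hxδ | hxδ
    · rw [hlow x hxδ, norm_zero]
      positivity
    · have h1 : ‖∫ v in δ..x, Real.exp (ratePrimitive μ δ v / b) * ψ v‖ ≤ J := by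
        rw [intervalIntegral.integral_of_le hxδ]
        refine (norm_integral_le_integral_norm _).trans ?_
        exact setIntegral_le_integral hNi.norm (Eventually.of_forall fun v => norm_nonneg _)
      have h2 : Real.exp (-(ratePrimitive μ δ x) / b) ≤ Real.exp (δ / b) * Real.exp (-b⁻¹ * x) := by
        rw [← Real.exp_add, Real.exp_le_exp]
        have := sub_le_ratePrimitive_sub hμ_tail hδ hδ hxδ
        have h0 : ratePrimitive μ δ δ = 0 := intervalIntegral.integral_same
        rw [h0, sub_zero] at this
        have e : δ / b + -b⁻¹ * x = -(x - δ) / b := by field_simp; ring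
        rw [e]
        gcongr
      rw [hpos x hx, hl, linearSolution, norm_mul, norm_mul, Real.norm_of_nonneg (by positivity),
        Real.norm_of_nonneg (Real.exp_pos _).le]
      calc _ ≤ b⁻¹ * (Real.exp (δ / b) * Real.exp (-b⁻¹ * x)) * J := by gcongr
        _ = _ := by ring
  have hlim : Tendsto h atTop (𝓝 0) := by
    have h1 : Tendsto (fun x => -b⁻¹ * x) atTop atBot :=
      tendsto_id.const_mul_atTop_of_neg (neg_lt_zero.2 (inv_pos.2 hb))
    have h2 := (Real.tendsto_exp_atBot.comp h1).const_mul (b⁻¹ * Real.exp (δ / b) * J)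
    rw [mul_zero] at h2
    refine squeeze_zero_norm' ?_ h2
    filter_upwards [eventually_gt_atTop 0] with x hx using hbound x hx
  have hint : IntegrableOn h (Ioi 0) := by
    have h1 := (exp_neg_integrableOn_Ioi 0 (inv_pos.2 hb)).const_mul (b⁻¹ * Real.exp (δ / b) * J)
    refine Integrable.mono' h1 hcont.aestronglyMeasurable ?_
    filter_upwards [ae_restrict_mem measurableSet_Ioi] with x hx using hbound x hx
  refine ⟨h, hcont, hlow, hlim, hint, fun x hx => ?_⟩
  have hliml : Tendsto l atTop (𝓝 0) := hlim.congr' (by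
    filter_upwards [eventually_gt_atTop 0] with v hv using hpos v hv)
  have hintl : IntegrableOn l (Ioi x) := (hint.mono_set (Ioi_subset_Ioi hx.le)).congr_fun
    (fun v hv => hpos v (hx.trans hv)) measurableSet_Ioi
  rw [hpos x hx, linearSolution_eq_integral_Ioi hμ_tail hb.ne' hδ hψ hψ0
    (integrable_of_continuous_of_eq_zero hψ hψ0 hψK) hliml hx hintl]
  refine setIntegral_congr_fun measurableSet_Ioi fun v hv => ?_
  simp only [rate]
  rw [hpos v (hx.trans hv)]

end PositiveDrift

section NegativeDrift

variable {μ : Measure ℝ} {b δ K : ℝ} {ψ : ℝ → ℝ}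

theorem tendsto_ratePrimitive_atBot [SFinite μ] (hμ_tail : ∀ x : ℝ, 0 < x → μ (Ici x) < ∞)
    (hinf : ∫⁻ v in Ioc (0 : ℝ) 1, μ (Ici v) = ∞) (hδ : 0 < δ) :
    Tendsto (ratePrimitive μ δ) (𝓝[>] 0) atBot := by
  have hnot : ∀ M : ℝ, ∃ x ∈ Ioc 0 δ, ratePrimitive μ δ x < M := by
    intro M
    by_contra! hM
    have hint : IntegrableOn (rate μ) (Ioc 0 δ) := by
      refine integrableOn_Ioc_of_intervalIntegral_norm_bounded_left (l := atTop)
        (a := fun n : ℕ => δ * (1 / ((n : ℝ) + 1))) (I := -M) (fun n => ?_) ?_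
        (Eventually.of_forall fun n => ?_)
      · have h1 : 0 < δ * (1 / ((n : ℝ) + 1)) := by positivity
        rcases le_total (δ * (1 / ((n : ℝ) + 1))) δ with h | h
        · exact (intervalIntegrable_iff_integrableOn_Ioc_of_le h).1
            (intervalIntegrable_rate hμ_tail h1 hδ)
        · rw [Ioc_eq_empty (not_lt.2 h)]; exact integrableOn_empty
      · simpa using (tendsto_one_div_add_atTop_nhds_zero_nat (𝕜 := ℝ)).const_mul δ
      · have h1 : 0 < δ * (1 / ((n : ℝ) + 1)) := by positivity
        have h2 : δ * (1 / ((n : ℝ) + 1)) ≤ δ := by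
          refine mul_le_of_le_one_right hδ.le ?_
          rw [div_le_one (by positivity)]
          linarith [Nat.cast_nonneg (α := ℝ) n]
        have h3 := hM _ ⟨h1, h2⟩
        rw [ratePrimitive, intervalIntegral.integral_symm, intervalIntegral.integral_of_le h2] at h3
        simp only [Real.norm_of_nonneg (rate_pos _).le]
        linarith
    have hfin : ∫⁻ v in Ioc (0 : ℝ) 1, μ (Ici v) < ∞ := by
      have hsub : Ioc (0 : ℝ) 1 ⊆ Ioc 0 δ ∪ Ioc δ 1 := fun v hv => by
        rcases le_or_gt v δ with h | h
        · exact Or.inl ⟨hv.1, h⟩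
        · exact Or.inr ⟨h, hv.2⟩
      refine (lintegral_mono_set hsub).trans_lt ((lintegral_union_le _ _ _).trans_lt
        (ENNReal.add_lt_top.2 ⟨?_, ?_⟩))
      · refine lt_of_le_of_lt ?_ hint.2
        refine setLIntegral_mono_ae' measurableSet_Ioc ?_
        filter_upwards [ae_measure_Ici_eq_Ioi (μ := μ)] with v hv hv'
        rw [hv, Real.enorm_of_nonneg (rate_pos v).le,
          ← ENNReal.ofReal_toReal (measure_Ioi_lt_top hμ_tail hv'.1).ne]
        exact ENNReal.ofReal_le_ofReal (le_add_of_nonneg_left zero_le_one)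
      · have : ∫⁻ v in Ioc δ 1, μ (Ici v) ≤ ∫⁻ _v in Ioc δ 1, μ (Ici δ) :=
          setLIntegral_mono' measurableSet_Ioc fun v hv => measure_mono (Ici_subset_Ici.2 hv.1.le)
        refine this.trans_lt ?_
        rw [setLIntegral_const, Real.volume_Ioc]
        exact ENNReal.mul_lt_top (hμ_tail δ hδ) ENNReal.ofReal_lt_top
    exact hfin.ne hinf
  refine tendsto_atBot.2 fun M => ?_
  obtain ⟨x, hx, hxM⟩ := hnot M
  filter_upwards [Ioo_mem_nhdsGT hx.1] with y hy
  have := sub_le_ratePrimitive_sub hμ_tail hδ hy.1 hy.2.le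
  linarith [hy.2]

theorem exists_solution_of_neg [SFinite μ] (hμ_tail : ∀ x : ℝ, 0 < x → μ (Ici x) < ∞) (hb : b < 0)
    (hinf : ∫⁻ v in Ioc (0 : ℝ) 1, μ (Ici v) = ∞)
    (hψ : Continuous ψ) (hδ : 0 < δ) (hψ0 : ∀ v ≤ δ, ψ v = 0) (hψK : ∀ v, K ≤ v → ψ v = 0) :
    ∃ h : ℝ → ℝ, Continuous h ∧ (∀ v ≤ 0, h v = 0) ∧ Tendsto h atTop (𝓝 0) ∧
      IntegrableOn h (Ioi 0) ∧ ∫⁻ v in Ioc (0 : ℝ) 1, ‖h v‖ₑ * μ (Ioi v) < ∞ ∧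
      ∀ x, 0 < x → b * h x = ∫ v in Ioi x, ((1 + μ.real (Ioi v)) * h v - ψ v) := by
  set l := linearSolution μ b δ K ψ with hl
  set h : ℝ → ℝ := (Ioi 0).indicator l with hh
  set c := b⁻¹ * ∫ v in K..δ, Real.exp (ratePrimitive μ δ v / b) * ψ v with hc
  have hneg : ∀ v ≤ 0, h v = 0 := fun v hv => indicator_of_notMem (notMem_Ioi.2 hv) _
  have hpos : ∀ v, 0 < v → h v = l v := fun v hv => indicator_of_mem (mem_Ioi.2 hv) _
  have hlow : ∀ v ≤ δ, l v = c * Real.exp (-(ratePrimitive μ δ v) / b) := fun v hv => by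
    rw [hl, linearSolution_eq_of_le hψ0 hμ_tail hδ hψ K hv, hc]
    ring
  have hhigh : ∀ v, K ≤ v → h v = 0 := fun v hv => by
    by_cases h0 : v ∈ Ioi (0 : ℝ)
    · have : ∫ w in K..v, Real.exp (ratePrimitive μ δ w / b) * ψ w = ∫ w in K..v, (0 : ℝ) :=
        intervalIntegral.integral_congr fun w hw => by
          rw [uIcc_of_le hv] at hw
          simp only [hψK w hw.1, mul_zero]
      rw [hh, indicator_of_mem h0, hl, linearSolution, this, intervalIntegral.integral_zero,
        mul_zero]
    · exact indicator_of_notMem h0 _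
  have hlc := continuousOn_linearSolution (b := b) (x₁ := K) hμ_tail hδ hψ hψ0
  have hcont : Continuous h := by
    refine continuous_iff_continuousAt.2 fun x => ?_
    rcases lt_trichotomy x 0 with hx | rfl | hx
    · have : (fun _ => (0 : ℝ)) =ᶠ[𝓝 x] h := by
        filter_upwards [Iio_mem_nhds hx] with v hv using (hneg v (le_of_lt hv)).symm
      exact continuousAt_const.congr this
    · rw [continuousAt_iff_continuous_left'_right', ContinuousWithinAt, ContinuousWithinAt,
        hneg 0 le_rfl]
      constructor
      · refine tendsto_const_nhds.congr' ?_
        filter_upwards [self_mem_nhdsWithin] with v hv using (hneg v (le_of_lt hv)).symm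
      · have h1 : Tendsto (fun v => -(ratePrimitive μ δ v) / b) (𝓝[>] 0) atBot := by
          have := (tendsto_ratePrimitive_atBot hμ_tail hinf hδ).const_mul_atBot
            (show 0 < -b⁻¹ from neg_pos.2 (inv_lt_zero.2 hb))
          refine this.congr fun v => ?_
          field_simp
        have h2 := (Real.tendsto_exp_atBot.comp h1).const_mul c
        rw [mul_zero] at h2
        refine h2.congr' ?_
        filter_upwards [Ioc_mem_nhdsGT hδ] with v hv
        rw [hpos v hv.1, hlow v hv.2]
        rfl
    · refine (hlc.continuousAt (Ioi_mem_nhds hx)).congr ?_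
      filter_upwards [Ioi_mem_nhds hx] with v hv using (hpos v hv).symm
  have hint : Integrable h := integrable_of_continuous_of_eq_zero hcont hneg hhigh
  have hlim : Tendsto h atTop (𝓝 0) := by
    refine tendsto_const_nhds.congr' ?_
    filter_upwards [eventually_ge_atTop K] with v hv using (hhigh v hv).symm
  have hbdd : ∀ v, 0 < v → v ≤ δ → |b * l v| ≤ |b * c| := by
    intro v hv hvδ
    rw [hlow v hvδ, ← mul_assoc, abs_mul (b * c), abs_of_pos (Real.exp_pos _)]
    refine mul_le_of_le_one_right (abs_nonneg _) (Real.exp_le_one_iff.2 ?_)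
    have := sub_le_ratePrimitive_sub hμ_tail hδ hv hvδ
    have h0 : ratePrimitive μ δ δ = 0 := intervalIntegral.integral_same
    exact div_nonpos_of_nonneg_of_nonpos (by linarith) hb.le
  have hrate : IntegrableOn (fun v => rate μ v * l v) (Ioc 0 δ) := by
    refine integrableOn_Ioc_of_intervalIntegral_norm_bounded_left (l := atTop)
      (a := fun n : ℕ => δ * (1 / ((n : ℝ) + 1))) (I := 2 * |b * c|) (fun n => ?_) ?_
      (Eventually.of_forall fun n => ?_)
    · have h1 : 0 < δ * (1 / ((n : ℝ) + 1)) := by positivity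
      rcases le_total (δ * (1 / ((n : ℝ) + 1))) δ with h | h
      · exact (intervalIntegrable_iff_integrableOn_Ioc_of_le h).1
          (linearSolution_sub hμ_tail hb.ne hδ hψ hψ0 h1 h).1
      · rw [Ioc_eq_empty (not_lt.2 h)]; exact integrableOn_empty
    · simpa using (tendsto_one_div_add_atTop_nhds_zero_nat (𝕜 := ℝ)).const_mul δ
    · have h1 : 0 < δ * (1 / ((n : ℝ) + 1)) := by positivity
      have h2 : δ * (1 / ((n : ℝ) + 1)) ≤ δ := by
        refine mul_le_of_le_one_right hδ.le ?_
        rw [div_le_one (by positivity)]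
        linarith [Nat.cast_nonneg (α := ℝ) n]
      set x := δ * (1 / ((n : ℝ) + 1)) with hx
      have h3 := (linearSolution_sub (x₁ := K) hμ_tail hb.ne hδ hψ hψ0 h1 h2).2
      have h4 : ∫ v in x..δ, (ψ v - rate μ v * l v) = ∫ v in x..δ, -(rate μ v * l v) :=
        intervalIntegral.integral_congr fun v hv => by
          rw [uIcc_of_le h2] at hv
          simp only [hψ0 v hv.2, zero_sub]
      rw [← hl, h4, intervalIntegral.integral_neg, intervalIntegral.integral_of_le h2] at h3
      have h5 : ∫ v in Ioc x δ, ‖rate μ v * l v‖ =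
          (SignType.sign c : ℝ) * ∫ v in Ioc x δ, rate μ v * l v := by
        rw [← integral_const_mul]
        refine setIntegral_congr_fun measurableSet_Ioc fun v hv => ?_
        rw [norm_mul, Real.norm_of_nonneg (rate_pos v).le, hlow v hv.2, norm_mul,
          Real.norm_of_nonneg (Real.exp_pos _).le, Real.norm_eq_abs, ← sign_mul_self]
        ring
      have h6 : |(SignType.sign c : ℝ)| ≤ 1 := by
        rcases lt_trichotomy c 0 with h | h | h
        · simp [sign_neg h]
        · simp [h]
        · simp [sign_pos h]
      rw [h5]
      refine (le_abs_self _).trans ?_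
      rw [abs_mul]
      refine (mul_le_of_le_one_left (abs_nonneg _) h6).trans ?_
      rw [← abs_neg, ← h3]
      refine (abs_sub _ _).trans ?_
      have := hbdd δ hδ le_rfl
      have := hbdd x h1 h2
      linarith
  have hfin : ∫⁻ v in Ioc (0 : ℝ) 1, ‖h v‖ₑ * μ (Ioi v) < ∞ := by
    have hsub : Ioc (0 : ℝ) 1 ⊆ Ioc 0 δ ∪ Ioc δ 1 := fun v hv => by
      rcases le_or_gt v δ with h | h
      · exact Or.inl ⟨hv.1, h⟩
      · exact Or.inr ⟨h, hv.2⟩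
    refine (lintegral_mono_set hsub).trans_lt ((lintegral_union_le _ _ _).trans_lt
      (ENNReal.add_lt_top.2 ⟨?_, ?_⟩))
    · refine lt_of_le_of_lt ?_ hrate.2
      refine setLIntegral_mono' measurableSet_Ioc fun v hv => ?_
      rw [hpos v hv.1, enorm_mul, mul_comm]
      gcongr
      rw [Real.enorm_of_nonneg (rate_pos v).le,
        ← ENNReal.ofReal_toReal (measure_Ioi_lt_top hμ_tail hv.1).ne]
      exact ENNReal.ofReal_le_ofReal (le_add_of_nonneg_left zero_le_one)
    · have : ∫⁻ v in Ioc δ 1, ‖h v‖ₑ * μ (Ioi v) ≤ ∫⁻ v in Ioc δ 1, ‖h v‖ₑ * μ (Ioi δ) :=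
        setLIntegral_mono' measurableSet_Ioc fun v hv =>
          mul_le_mul_right (measure_mono (Ioi_subset_Ioi hv.1.le)) _
      refine this.trans_lt ?_
      rw [lintegral_mul_const _ hcont.measurable.enorm]
      exact ENNReal.mul_lt_top hint.integrableOn.2 (measure_Ioi_lt_top hμ_tail hδ)
  refine ⟨h, hcont, hneg, hlim, hint.integrableOn, hfin, fun x hx => ?_⟩
  have hliml : Tendsto l atTop (𝓝 0) := hlim.congr' (by
    filter_upwards [eventually_gt_atTop 0] with v hv using hpos v hv)
  have hintl : IntegrableOn l (Ioi x) := hint.integrableOn.congr_fun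
    (fun v hv => hpos v (hx.trans hv)) measurableSet_Ioi
  rw [hpos x hx, linearSolution_eq_integral_Ioi hμ_tail hb.ne hδ hψ hψ0
    (integrable_of_continuous_of_eq_zero hψ hψ0 hψK) hliml hx hintl]
  refine setIntegral_congr_fun measurableSet_Ioi fun v hv => ?_
  simp only [rate]
  rw [hpos v (hx.trans hv)]

end NegativeDrift

section Cores

variable {μ : Measure ℝ} [SFinite μ] {b : ℝ} {ρ : ℝ≥0 → Measure ℝ}
  [∀ t, IsProbabilityMeasure (ρ t)]

theorem IsNoiseFamily.dense_range_D0 (hρ : IsNoiseFamily μ b ρ)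
    (hμ_tail : ∀ x : ℝ, 0 < x → μ (Ici x) < ∞) (hb : 0 ≤ b) (k : C₀(ℝ≥0, ℝ)) {ε : ℝ} (hε : 0 < ε) :
    ∃ q ∈ infinitesimalGraph (fun t => transition b t (ρ t)),
      q.1 ∈ D0 ∧ ‖q.1 - q.2 - k‖ < ε := by
  have hε3 : 0 < ε / 3 := by positivity
  obtain ⟨ψ, δ, K, hψ, hδ, hψ0, hψK, hk⟩ := exists_integral_Ioi_approx k hε3
  have hψi := integrable_of_continuous_of_eq_zero hψ hψ0 hψK
  obtain ⟨h, hc, h0, hlim, hint, happ⟩ : ∃ h : ℝ → ℝ, Continuous h ∧ (∀ v ≤ δ / 2, h v = 0) ∧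
      Tendsto h atTop (𝓝 0) ∧ IntegrableOn h (Ioi 0) ∧ ∀ x, 0 < x →
        |b * h x - ∫ v in Ioi x, ((1 + μ.real (Ioi v)) * h v - ψ v)| ≤ ε / 3 := by
    rcases hb.eq_or_lt with rfl | hb
    · obtain ⟨h, hc, hsupp, h0, happ⟩ :=
        exists_approx_resolvent_of_zero_drift hμ_tail hψ hδ hψ0 hψK hε3
      refine ⟨h, hc, h0, ?_, (hc.integrable_of_hasCompactSupport hsupp).integrableOn,
        fun x hx => ?_⟩
      · have := hsupp.is_zero_at_infty
        rw [cocompact_eq_atBot_atTop] at this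
        exact this.mono_left le_sup_right
      · rw [zero_mul, zero_sub, abs_neg]
        exact happ x hx
    · obtain ⟨h, hc, h0, hlim, hint, heq⟩ := exists_solution_of_pos hμ_tail hb hψ hδ hψ0 hψK
      refine ⟨h, hc, fun v hv => h0 v (by linarith), hlim, hint, fun x hx => ?_⟩
      rw [heq x hx, sub_self, abs_zero]
      exact hε3.le
  obtain ⟨C, hC⟩ := (isCompact_Icc (a := (0 : ℝ)) (b := 1)).exists_bound_of_continuousOn
    hc.continuousOn
  have hfin := (lintegral_Ioi_le_Ici h (Ioc (0 : ℝ) 1)).trans_lt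
    (lintegral_lt_top_of_eq_zero hμ_tail (fun v hv => hC v ⟨hv.1.le, hv.2⟩) (half_pos hδ)
      fun v _ hv => h0 v hv)
  obtain ⟨f, g, hfg, hf, hle⟩ := hρ.exists_norm_sub_sub_le hμ_tail hc
    (fun v hv => h0 v (by linarith)) hlim hint hfin hψi hε3.le happ fun x _ => hk x
  exact ⟨(f, g), hfg, hf.mem_D0 (half_pos hδ) h0, hle.trans_lt (by linarith)⟩

theorem IsNoiseFamily.dense_range_D1 (hρ : IsNoiseFamily μ b ρ)
    (hμ_tail : ∀ x : ℝ, 0 < x → μ (Ici x) < ∞) (hb : b < 0)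
    (hinf : ∫⁻ v in Ioc (0 : ℝ) 1, μ (Ici v) = ∞) (k : C₀(ℝ≥0, ℝ)) {ε : ℝ} (hε : 0 < ε) :
    ∃ q ∈ infinitesimalGraph (fun t => transition b t (ρ t)),
      q.1 ∈ D1 μ ∧ ‖q.1 - q.2 - k‖ < ε := by
  have hε3 : 0 < ε / 3 := by positivity
  obtain ⟨ψ, δ, K, hψ, hδ, hψ0, hψK, hk⟩ := exists_integral_Ioi_approx k hε3
  have hψi := integrable_of_continuous_of_eq_zero hψ hψ0 hψK
  obtain ⟨h, hc, h0, hlim, hint, hfin, heq⟩ :=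
    exists_solution_of_neg hμ_tail hb hinf hψ hδ hψ0 hψK
  obtain ⟨f, g, hfg, hf, hle⟩ := hρ.exists_norm_sub_sub_le hμ_tail hc h0 hlim hint hfin hψi
    hε3.le (fun x hx => by rw [heq x hx, sub_self, abs_zero]; exact hε3.le) fun x _ => hk x
  exact ⟨(f, g), hfg, hf.mem_D1 hfin, hle.trans_lt (by linarith)⟩

theorem IsNoiseFamily.D1_subset_domain (hρ : IsNoiseFamily μ b ρ)
    (hμ_tail : ∀ x : ℝ, 0 < x → μ (Ici x) < ∞) :
    D1 μ ⊆ domain (infinitesimalGraph fun t => transition b t (ρ t)) := fun _ hf => by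
  obtain ⟨φ, hφ, hfin⟩ := exists_hasNiceDeriv_of_mem_D1 hf
  obtain ⟨g, hg, -⟩ := hρ.exists_mem_infinitesimalGraph hφ hμ_tail hfin
  exact ⟨g, hg⟩

theorem IsNoiseFamily.integrableOn_and_apply_eq (hρ : IsNoiseFamily μ b ρ)
    (hμ_tail : ∀ x : ℝ, 0 < x → μ (Ici x) < ∞) {f g : C₀(ℝ≥0, ℝ)} (hf : f ∈ D1 μ)
    (hfg : (f, g) ∈ infinitesimalGraph fun t => transition b t (ρ t)) (x : ℝ≥0) :
    IntegrableOn (fun y => toRealFun f y - f x) (Ioi (x : ℝ)) μ ∧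
      g x = (∫ y in Ioi (x : ℝ), (toRealFun f y - f x) ∂μ) - b * deriv₀ f x := by
  obtain ⟨φ, hφ, hfin⟩ := exists_hasNiceDeriv_of_mem_D1 hf
  obtain ⟨g', hg', heq⟩ := hρ.exists_mem_infinitesimalGraph hφ hμ_tail hfin
  have hx : (0 : ℝ) ≤ x := x.2
  have hint := (hφ.jumpPart_eq hμ_tail hfin hx (le_add_of_nonneg_right zero_le_one)
    (by linarith : (0 : ℝ) < x + 1)).1
  rw [toRealFun_coe] at hint
  refine ⟨hint, ?_⟩
  have : g = g' := tendsto_nhds_unique hfg hg'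
  rw [this, heq x, hφ.deriv₀_eq hx, jumpPart, toRealFun_coe]

end Cores

end ESN

theorem theorem2p2 {Ω : Type*} [MeasurableSpace Ω] (P : Measure Ω) [IsProbabilityMeasure P]
    (b : ℝ) (μ : Measure ℝ) (hμ_pos : μ (Iic 0) = 0) (hμ_tail : ∀ x : ℝ, 0 < x → μ (Ici x) < ∞)
    (S : Ω → Set (ℝ × ℝ)) (hS : ESN.IsPoissonPointProcess P S (ESN.intensity μ)) :
    let G := ESN.generatorGraph (ESN.semigroup P b S)
    ESN.D0 ⊆ ESN.D1 μ ∧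
    ESN.D1 μ ⊆ ESN.domain G ∧
    (∀ f ∈ ESN.D1 μ, ∀ g, (f, g) ∈ G → ∀ x : ℝ≥0,
      IntegrableOn (fun y => ESN.toRealFun f y - f x) (Ioi (x : ℝ)) μ ∧
      g x = (∫ y in Ioi (x : ℝ), (ESN.toRealFun f y - f x) ∂μ) - b * ESN.deriv₀ f x) ∧
    (0 < b → ESN.IsCore G ESN.D0 ∧ ESN.IsCore G (ESN.D1 μ)) ∧
    (b ≤ 0 → ∫⁻ v in Ioc (0 : ℝ) 1, μ (Ici v) = ∞ → ESN.IsCore G (ESN.D1 μ)) := by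
  have hσ : SigmaFinite μ := ESN.sigmaFinite_of_tail hμ_pos hμ_tail
  have hprob := fun t => ESN.isProbabilityMeasure_noiseLaw (P := P) hS b t
  have hρ := ESN.isNoiseFamily_noiseLaw (P := P) hμ_tail hS b
  have hT := hρ.isContractionSemigroup hμ_tail
  have hD := hρ.D1_subset_domain hμ_tail
  have h01 : ESN.D0 ⊆ ESN.D1 μ := ESN.D0_subset_D1 hμ_tail
  intro G
  have hG : G = infinitesimalGraph fun t => ESN.transition b t (ESN.noiseLaw P b S t) :=
    ESN.generatorGraph_eq hμ_tail hS b
  rw [hG]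
  refine ⟨h01, hD, fun f hf g hfg x => hρ.integrableOn_and_apply_eq hμ_tail hf hfg x,
    fun hb => ⟨⟨h01.trans hD, ?_⟩, hD, ?_⟩, fun hb hinf => ⟨hD, ?_⟩⟩
  · exact hT.closure_restrict_eq _ fun k ε hε => hρ.dense_range_D0 hμ_tail hb.le k hε
  · refine hT.closure_restrict_eq _ fun k ε hε => ?_
    obtain ⟨q, hq, hqD, hle⟩ := hρ.dense_range_D0 hμ_tail hb.le k hε
    exact ⟨q, hq, h01 hqD, hle⟩
  · refine hT.closure_restrict_eq _ fun k ε hε => ?_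
    rcases hb.eq_or_lt with hb | hb
    · obtain ⟨q, hq, hqD, hle⟩ := hρ.dense_range_D0 hμ_tail hb.ge k hε
      exact ⟨q, hq, h01 hqD, hle⟩
    · exact hρ.dense_range_D1 hμ_tail hb hinf k hε
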